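/- For $w\in\mathbb C\setminus(-\infty,0]$ let $\Gamma(a,w)=\int_w^{\infty}t^{a-1}e^{-t}\,dt$ be the principal branch of the upper incomplete gamma function. For real $a<1$ and $z>0$, the modulus function $M(a,z)$ and the phase function $\varphi(a,z)$ are the real-valued functions, continuous in $z>0$, with $M(a,z)>0$, \[ M(a,z)\,e^{i\varphi(a,z)}=e^{\frac{\pi}{2}ia}\,\Gamma\!\left(a,ze^{-\frac{\pi}{2}i}\right)\quad(z>0),\qquad \lim_{z\to0^+}\varphi(a,z)=\tfrac{\pi}{4}\left(a+|a|\right). \] Theorem. There are monic polynomials $t_n(x)\in\mathbb Z[x]$ of degree $2n+1$ ($n=0,1,2,\dots$) such that the following holds for every real $a<1$. The functions $M(a,\cdot)$ and $\varphi(a,\cdot)$ exist, $t_n(1-a)>0$ for all $n\ge 0$, and the $t_n(1-a)$ are the coefficients of the asymptotic expansion \[ \varphi(a,z)\sim z+\frac{\pi}{2}-\sum_{n=0}^{\infty}(-1)^n\frac{t_n(1-a)}{2n+1}\frac{1}{z^{2n+1}}\qquad(z\to+\infty). \] The phase function $\varphi(a,z)$ extends analytically to the half-plane $\operatorname{Re}(z)>0$.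 For every integer $N\ge 0$ and every $z$ with $\operatorname{Re}(z)>0$, the extended function satisfies \[ \varphi(a,z)=z+\frac{\pi}{2}-\sum_{n=0}^{N-1}(-1)^n\frac{t_n(1-a)}{2n+1}\frac{1}{z^{2n+1}}+R_N^{(\varphi)}(a,z), \] where \[ \left|R_N^{(\varphi)}(a,z)\right|\le\frac{t_N(1-a)}{2N+1}\frac{1}{|z|^{2N+1}}\times\begin{cases}1&\text{if } |\arg z|\le\frac{\pi}{4},\\ \left|\csc(2\arg z)\right|&\text{if } \frac{\pi}{4}<|\arg z|<\frac{\pi}{2}.\end{cases} \] Moreover, if $z>0$, then $R_N^{(\varphi)}(a,z)$ is real, does not exceed the first neglected term $(-1)^{N+1}\frac{t_N(1-a)}{2N+1}\frac{1}{z^{2N+1}}$ in absolute value, and has the same sign as that term. -/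

import Mathlib

open scoped Polynomial

noncomputable section

/-- The principal branch of the upper incomplete gamma function
`Γ(a, w) = ∫_w^∞ t ^ (a - 1) * exp (-t) dt`, for `w` outside the half-line `(-∞, 0]`.
The path of integration is the horizontal ray `t = w + s`, `0 < s < ∞`, which does not meet
`(-∞, 0]`, and `t ^ (a - 1)` has its principal value; the integral converges absolutely. -/
def upperIncGamma (a w : ℂ) : ℂ :=
  ∫ s : ℝ in Set.Ioi 0, (w + (s : ℂ)) ^ (a - 1) * Complex.exp (-(w + (s : ℂ)))

/-- `M` and `φ`, as functions of `z > 0`, are the modulus and the phase function of the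
generalised trigonometric integrals with parameter `a`:
`M(z) e^{i φ(z)} = e^{π i a / 2} Γ(a, z e^{-π i / 2})` for `z > 0`, where `M` is continuous and
positive, `φ` is continuous, and the branch of `φ` is fixed by `φ(z) → (π / 4) (a + |a|)` as
`z → 0+`. These conditions determine `M` and `φ` on `(0, ∞)`. -/
structure IsModulusPhase (a : ℝ) (M φ : ℝ → ℝ) : Prop where
  continuousOn_modulus : ContinuousOn M (Set.Ioi 0)
  continuousOn_phase : ContinuousOn φ (Set.Ioi 0)
  modulus_pos : ∀ z : ℝ, 0 < z → 0 < M z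
  polar : ∀ z : ℝ, 0 < z →
    (M z : ℂ) * Complex.exp (Complex.I * (φ z : ℂ)) =
      Complex.exp ((Real.pi : ℂ) / 2 * Complex.I * (a : ℂ)) *
        upperIncGamma (a : ℂ) ((z : ℂ) * Complex.exp (-((Real.pi : ℂ) / 2 * Complex.I)))
  tendsto_phase : Filter.Tendsto φ (nhdsWithin 0 (Set.Ioi 0))
    (nhds (Real.pi / 4 * (a + |a|)))

/-- The truncated expansion `z + π / 2 - ∑_{n < N} (-1)^n c_n / ((2 n + 1) z ^ (2 n + 1))`. -/
def phasePartialSum (c : ℕ → ℝ) (N : ℕ) (z : ℂ) : ℂ :=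
  z + (Real.pi : ℂ) / 2 -
    ∑ n ∈ Finset.range N, (-1 : ℂ) ^ n * ((c n : ℂ) / (2 * (n : ℂ) + 1)) * (1 / z ^ (2 * n + 1))

/-- The asymptotic expansion
`φ(z) ∼ z + π / 2 - ∑ (-1)^n c_n / ((2 n + 1) z ^ (2 n + 1))` as `z → +∞`. -/
def HasPhaseExpansion (φ : ℝ → ℝ) (c : ℕ → ℝ) : Prop :=
  ∀ N : ℕ, Asymptotics.IsBigO Filter.atTop
    (fun z : ℝ => (φ z : ℂ) - phasePartialSum c N (z : ℂ))
    (fun z : ℝ => 1 / z ^ (2 * N + 1))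

/-- The factor that multiplies the first neglected term in the error bound, as a function of
`θ = arg z`: it is `1` for `|θ| ≤ π / 4` and `|csc (2 θ)|` for `π / 4 < |θ| < π / 2`. -/
def phaseErrorFactor (θ : ℝ) : ℝ :=
  if |θ| ≤ Real.pi / 4 then 1 else |(Real.sin (2 * θ))⁻¹|

end

/-!
Write `μ = 1 - a > 0` and let `m` be the gamma distribution of shape `μ` and rate `1`, with moments
`b_n = μ (μ + 1) ⋯ (μ + n - 1)`. Since `(1 + i s / z)^(-μ)` is the Laplace transform of
`m` at `i s / z`, Fubini's theorem gives `e^{π i a / 2} Γ(a, z e^{-π i / 2}) = i e^{i z} z^(-μ) W(z)` with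
`W(z) = ∫ z / (z + i t) dm(t)` (`exp_mul_upperIncGamma`). For `z > 0` the values of `W` lie in the
lower half-plane, so `φ(a, z) = z + π / 2 + arg W(z)`; the normalisation at `z → 0` is
`tendsto_arg_stieltjes_of_pos` for `a > 0` and `tendsto_arg_stieltjes_of_nonpos` for `a ≤ 0`. The
analytic extension replaces `arg W` by half the difference, divided by `i`, of the logarithms of
`∫ z / (z + i t) dm(t)` and `∫ z / (z - i t) dm(t)`.

The estimates rest on a structural fact: for a probability measure `m` on `(0, ∞)`,
`∫ w / (w + t) dm(t) = exp (-∫ ω(x) / (w + x) dx)` with a density `0 ≤ ω ≤ 1`, hence the phase is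
`-∫ ω(x) z / (z² + x²) dx`. Geometric expansion of the kernel then produces the asymptotic series,
with coefficients `∫ ω(x) x^(2n) dx`, and the error bounds. The density `ω` itself is never
constructed. For a discrete measure the zeros and poles of the rational function `∑ mᵢ w / (w + tᵢ)`
interlace (`exists_interlacing`), so that `ω` is the indicator function of a finite union of
intervals (`exists_set_of_discrete`). The integral of finitely many test functions against `m` lies
in the closed convex hull of their values, so `m` can be replaced by discrete measures with moments
and phase at a given point converging to those of `m` (`exists_seq_set`). All weak inequalities pass
to the limit, and so do two lower bounds that give strict positivity.

The coefficients satisfy Newton's identities `(n + 1) b_{n+1} = ∑ T_k b_{n-k}` with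
`T_n = (n + 1) ∫ ω(x) x^n dx`, because `b_n` and `T_n` are formally complete homogeneous sums and power
sums. So `T_n` is a polynomial in `μ` with integer coefficients, monic of degree `n + 1`, and
`t_n = T_{2n}`.
-/

open Finset

/-! ### Newton's identities -/

/-- The power sums `T₀, T₁, …` attached to complete homogeneous symmetric sums `b₀ = 1, b₁, …` by
Newton's identities `(n + 1) b_{n+1} = ∑_{k ≤ n} T_k b_{n-k}`; here `T_n` is the power sum of
degree `n + 1`. -/
def newtonSum {R : Type*} [CommRing R] (b : ℕ → R) : ℕ → R
  | n => ((n : R) + 1) * b (n + 1) - ∑ k : Fin n, newtonSum b k * b (n - k)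

theorem newtonSum_eq {R : Type*} [CommRing R] (b : ℕ → R) (n : ℕ) :
    newtonSum b n = ((n : R) + 1) * b (n + 1) - ∑ k ∈ range n, newtonSum b k * b (n - k) := by
  rw [newtonSum, Finset.sum_range (fun k => newtonSum b k * b (n - k))]

theorem eq_newtonSum {R : Type*} [CommRing R] {b T : ℕ → R} (hb : b 0 = 1)
    (h : ∀ n, ∑ k ∈ range (n + 1), T k * b (n - k) = ((n : R) + 1) * b (n + 1)) (n : ℕ) :
    T n = newtonSum b n := by
  induction n using Nat.strong_induction_on with
  | _ n ih =>
    have h1 := h n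
    rw [sum_range_succ, Nat.sub_self, hb, mul_one] at h1
    rw [newtonSum_eq, ← h1, sum_congr rfl fun k hk => by rw [ih k (mem_range.1 hk)]]
    ring

theorem map_newtonSum {R S : Type*} [CommRing R] [CommRing S] (f : R →+* S) (b : ℕ → R) (n : ℕ) :
    f (newtonSum b n) = newtonSum (fun k => f (b k)) n := by
  induction n using Nat.strong_induction_on with
  | _ n ih =>
    rw [newtonSum_eq, newtonSum_eq, map_sub, map_sum, map_mul, map_add, map_one, map_natCast]
    congr 1
    exact sum_congr rfl fun k hk => by rw [map_mul, ih k (mem_range.1 hk)]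

theorem tendsto_newtonSum {ι : Type*} {l : Filter ι} {b : ι → ℕ → ℝ} {c : ℕ → ℝ} (n : ℕ)
    (h : ∀ j ≤ n + 1, Filter.Tendsto (fun i => b i j) l (nhds (c j))) :
    Filter.Tendsto (fun i => newtonSum (b i) n) l (nhds (newtonSum c n)) := by
  induction n using Nat.strong_induction_on with
  | _ n ih =>
    rw [newtonSum_eq]
    simp_rw [newtonSum_eq _ n]
    refine ((h _ le_rfl).const_mul _).sub (tendsto_finsetSum _ fun k hk => ?_)
    have hk := mem_range.1 hk
    exact (ih k hk fun j hj => h j (by omega)).mul (h _ (by omega))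

/-- The coefficient of `X ^ (n + 1)` in `T_n`, when `b_n` is the rising factorial. These
coefficients satisfy Newton's identities with all `b_n = 1`, whose solution is
`T_n = 1`. -/
theorem newtonSum_ascPochhammer_monic (n : ℕ) :
    (newtonSum (ascPochhammer ℤ) n).Monic ∧
      (newtonSum (ascPochhammer ℤ) n).natDegree = n + 1 := by
  suffices h : (newtonSum (ascPochhammer ℤ) n).natDegree ≤ n + 1 ∧
      (newtonSum (ascPochhammer ℤ) n).coeff (n + 1) = 1 by
    have hd : (newtonSum (ascPochhammer ℤ) n).natDegree = n + 1 :=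
      le_antisymm h.1 (Polynomial.le_natDegree_of_ne_zero (by rw [h.2]; exact one_ne_zero))
    exact ⟨by rw [Polynomial.Monic, Polynomial.leadingCoeff, hd, h.2], hd⟩
  have hb : ∀ k, (ascPochhammer ℤ k).coeff k = 1 := fun k => by
    have := (monic_ascPochhammer ℤ k).coeff_natDegree
    rwa [ascPochhammer_natDegree] at this
  induction n using Nat.strong_induction_on with
  | _ n ih =>
    have key : ∀ k ∈ range n, n + 1 = (k + 1) + (n - k) := fun k hk => by
      have := mem_range.1 hk; omega
    have hC : ((n : ℤ[X]) + 1) = Polynomial.C ((n : ℤ) + 1) := by simp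
    rw [newtonSum_eq, hC]
    constructor
    · refine (Polynomial.natDegree_sub_le _ _).trans (max_le ?_ ?_)
      · exact (Polynomial.natDegree_C_mul_le _ _).trans (ascPochhammer_natDegree _ _).le
      · refine Polynomial.natDegree_sum_le_of_forall_le _ _ fun k hk => ?_
        rw [key k hk]
        exact Polynomial.natDegree_mul_le_of_le (ih k (mem_range.1 hk)).1
          (ascPochhammer_natDegree _ _).le
    · have h2 : (∑ k ∈ range n, newtonSum (ascPochhammer ℤ) k * ascPochhammer ℤ (n - k)).coeff
          (n + 1) = n := by
        rw [Polynomial.finsetSum_coeff, sum_congr rfl (g := fun _ => (1 : ℤ)), sum_const,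
          card_range, nsmul_one]
        intro k hk
        conv_lhs => rw [key k hk]
        rw [Polynomial.coeff_mul_add_eq_of_natDegree_le (ih k (mem_range.1 hk)).1
          (ascPochhammer_natDegree _ _).le, (ih k (mem_range.1 hk)).2, hb, mul_one]
      rw [Polynomial.coeff_sub, Polynomial.coeff_C_mul, hb, h2]
      ring

/-! ### Interlacing of zeros and poles of discrete Stieltjes transforms -/

theorem exists_mem_Ioo_eq_zero_of_mul_neg {f : ℝ → ℝ} {a b : ℝ} (hab : a < b)
    (hf : ContinuousOn f (Set.Icc a b)) (h : f a * f b < 0) : ∃ x ∈ Set.Ioo a b, f x = 0 := by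
  rcases mul_neg_iff.1 h with ⟨h1, h2⟩ | ⟨h1, h2⟩
  · exact intermediate_value_Ioo' hab.le hf ⟨h2, h1⟩
  · exact intermediate_value_Ioo hab.le hf ⟨h1, h2⟩

/-- The numerator, as a polynomial in `X = 1 / w`, of `∑ mᵢ w / (w + tᵢ)` over the common
denominator `∏ (1 + tᵢ X)`. -/
noncomputable def stieltjesNumerator {ι : Type*} [Fintype ι] [DecidableEq ι] (t m : ι → ℝ) : ℝ[X] :=
  ∑ i, Polynomial.C (m i) * ∏ j ∈ univ.erase i, (1 + Polynomial.C (t j) * Polynomial.X)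

theorem eval_stieltjesNumerator {ι : Type*} [Fintype ι] [DecidableEq ι] (t m : ι → ℝ)
    (i : ι) (hi : t i ≠ 0) : (stieltjesNumerator t m).eval (-1 / t i) =
      m i * ∏ j ∈ univ.erase i, (1 - t j / t i) := by
  rw [stieltjesNumerator, Polynomial.eval_finsetSum, sum_eq_single i]
  · simp only [Polynomial.eval_mul, Polynomial.eval_C, Polynomial.eval_prod, Polynomial.eval_add,
      Polynomial.eval_one, Polynomial.eval_X]
    congr 1
    exact prod_congr rfl fun j _ => by ring
  · intro k _ hk
    rw [Polynomial.eval_mul, Polynomial.eval_prod, prod_eq_zero (i := i), mul_zero]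
    · simp [hk.symm]
    · simp only [Polynomial.eval_add, Polynomial.eval_one, Polynomial.eval_mul, Polynomial.eval_C,
        Polynomial.eval_X]
      field_simp
      ring
  · simp

theorem natDegree_prod_one_add_le {ι : Type*} (S : Finset ι) (t : ι → ℝ) :
    (∏ j ∈ S, (1 + Polynomial.C (t j) * Polynomial.X)).natDegree ≤ #S := by
  refine (Polynomial.natDegree_prod_le _ _).trans ((sum_le_card_nsmul _ _ 1 fun j _ => ?_).trans
    (by simp))
  compute_degree

/-- Two neighbouring poles of `∑ mᵢ w / (w + tᵢ)` enclose a zero: at `-1 / t_k` only the `k`-th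
summand of the numerator survives, and its sign alternates with `k`. -/
theorem exists_root_stieltjesNumerator {n : ℕ} {t m : Fin (n + 1) → ℝ} (ht : StrictMono t)
    (ht0 : ∀ i, 0 < t i) (hm : ∀ i, 0 < m i) (k : Fin n) :
    ∃ x ∈ Set.Ioo (t k.castSucc) (t k.succ), (stieltjesNumerator t m).eval (-1 / x) = 0 := by
  set a := k.castSucc with ha
  set b := k.succ with hb
  have hab : a < b := Fin.castSucc_lt_succ
  refine exists_mem_Ioo_eq_zero_of_mul_neg (ht hab) ?_ ?_
  · refine (Polynomial.continuous _).comp_continuousOn ?_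
    exact continuousOn_const.div continuousOn_id fun x hx => ((ht0 a).trans_le hx.1).ne'
  -- Of the factors `1 - t_j / t_a` and `1 - t_j / t_b`, those with `j ∉ {a, b}` have equal signs.
  · rw [eval_stieltjesNumerator _ _ _ (ht0 a).ne', eval_stieltjesNumerator _ _ _ (ht0 b).ne',
      ← mul_prod_erase (univ.erase a) _ (mem_erase.2 ⟨hab.ne', mem_univ b⟩),
      ← mul_prod_erase (univ.erase b) _ (mem_erase.2 ⟨hab.ne, mem_univ a⟩), erase_right_comm]
    have h1 : 0 < (∏ j ∈ (univ.erase b).erase a, (1 - t j / t a)) *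
        ∏ j ∈ (univ.erase b).erase a, (1 - t j / t b) := by
      rw [← prod_mul_distrib]
      refine prod_pos fun j hj => ?_
      obtain ⟨hja, hjb, -⟩ : j ≠ a ∧ j ≠ b ∧ True := by simpa using hj
      rcases lt_or_gt_of_ne hja with h | h
      · have h' := h.trans hab
        exact mul_pos (sub_pos.2 ((div_lt_one (ht0 a)).2 (ht h)))
          (sub_pos.2 ((div_lt_one (ht0 b)).2 (ht h')))
      · have h' : b < j := lt_of_le_of_ne (by
          rw [hb, Fin.le_def]; rw [ha, Fin.lt_def] at h; simpa using h) hjb.symm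
        exact mul_pos_of_neg_of_neg (sub_neg.2 ((one_lt_div (ht0 a)).2 (ht h)))
          (sub_neg.2 ((one_lt_div (ht0 b)).2 (ht h')))
    have h2 : (1 - t b / t a) < 0 := sub_neg.2 ((one_lt_div (ht0 a)).2 (ht hab))
    have h3 : 0 < (1 - t a / t b) := sub_pos.2 ((div_lt_one (ht0 b)).2 (ht hab))
    have h4 := mul_neg_of_neg_of_pos
      (mul_neg_of_neg_of_pos h2 h3) (mul_pos (mul_pos (hm a) (hm b)) h1)
    exact lt_of_eq_of_lt (by ring) h4

/-- Zeros and poles of `∑ mᵢ w / (w + tᵢ)` interlace: apart from `s₀ = 0`, the zeros `-sᵢ` are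
simple and there is exactly one between neighbouring poles. -/
theorem exists_interlacing {n : ℕ} {t m : Fin (n + 1) → ℝ} (ht : StrictMono t)
    (ht0 : ∀ i, 0 < t i) (hm : ∀ i, 0 < m i) (hsum : ∑ i, m i = 1) :
    ∃ s : Fin (n + 1) → ℝ, (∀ i, 0 ≤ s i) ∧ (∀ i, s i < t i) ∧ (∀ i j, i < j → t i < s j) ∧
      stieltjesNumerator t m = ∏ i, (1 + Polynomial.C (s i) * Polynomial.X) := by
  choose r hr hr0 using fun k => exists_root_stieltjesNumerator ht ht0 hm k
  have hrpos : ∀ k, 0 < r k := fun k => (ht0 _).trans (hr k).1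
  have hrmono : StrictMono r := fun i j hij =>
    (hr i).2.trans_le ((ht.monotone (by rw [Fin.le_def]; simpa using hij)).trans (hr j).1.le)
  refine ⟨Fin.cons 0 r, ?_, ?_, ?_, ?_⟩
  · exact Fin.cases le_rfl fun k => (hrpos k).le
  · exact Fin.cases (ht0 0) fun k => (hr k).2
  · intro i j
    refine Fin.cases (fun h => absurd h (by simp)) (fun k h => ?_) j
    refine lt_of_le_of_lt (ht.monotone ?_) (hr k).1
    rw [Fin.lt_def] at h
    rw [Fin.le_def]
    simpa [Nat.lt_succ_iff] using h
  -- Both sides have degree at most `n` and agree at the `n + 1` points `0` and `-1 / r_k`.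
  · refine Polynomial.eq_of_degrees_lt_of_eval_index_eq (s := univ)
      (v := Fin.cons 0 fun k => -1 / r k) ?_ ?_ ?_ ?_
    · refine Function.Injective.injOn (Fin.cons_injective_iff.2 ⟨?_, fun i j h => ?_⟩)
      · rintro ⟨k, hk⟩
        exact (div_ne_zero (by norm_num) (hrpos k).ne') hk
      · have := (hrpos i).ne'
        have := (hrpos j).ne'
        refine hrmono.injective ?_
        replace h : -1 / r i = -1 / r j := h
        field_simp at h
        linarith
    · refine lt_of_le_of_lt (Polynomial.degree_le_of_natDegree_le (n := n) ?_) (by simp; norm_cast; simp)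
      refine Polynomial.natDegree_sum_le_of_forall_le _ _ fun i _ => ?_
      refine (Polynomial.natDegree_C_mul_le _ _).trans ((natDegree_prod_one_add_le _ _).trans ?_)
      simp
    · refine lt_of_le_of_lt (Polynomial.degree_le_of_natDegree_le (n := n) ?_) (by simp; norm_cast; simp)
      rw [Fin.prod_univ_succ]
      simpa using natDegree_prod_one_add_le univ r
    · refine fun i _ => Fin.cases ?_ (fun k => ?_) i
      · simp [stieltjesNumerator, Polynomial.eval_finsetSum, Polynomial.eval_prod, hsum]
      · rw [Fin.cons_succ, hr0, Polynomial.eval_prod]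
        refine (prod_eq_zero (mem_univ k.succ) ?_).symm
        have := (hrpos k).ne'
        simp
        field_simp
        simp

/-- The geometric series `1 / (1 + a X)`. -/
noncomputable def geomSeries (a : ℝ) : PowerSeries ℝ := PowerSeries.mk fun n => (-a) ^ n

theorem one_add_mul_geomSeries (a : ℝ) :
    (1 + PowerSeries.C a * PowerSeries.X) * geomSeries a = 1 := by
  ext n
  rw [add_mul, one_mul, mul_assoc, map_add, PowerSeries.coeff_C_mul]
  cases n with
  | zero => simp [geomSeries]
  | succ n => simp [geomSeries, PowerSeries.coeff_succ_X_mul, pow_succ]; ring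

theorem derivative_one_add_mul (a : ℝ) :
    PowerSeries.derivative ℝ (1 + PowerSeries.C a * PowerSeries.X) =
      (1 + PowerSeries.C a * PowerSeries.X) * (PowerSeries.C a * geomSeries a) := by
  rw [mul_left_comm, one_add_mul_geomSeries, ← PowerSeries.smul_eq_C_mul]
  simp [PowerSeries.smul_eq_C_mul]

theorem derivative_geomSeries (a : ℝ) : PowerSeries.derivative ℝ (geomSeries a) =
    geomSeries a * -(PowerSeries.C a * geomSeries a) := by
  have h := congrArg (PowerSeries.derivative ℝ) (one_add_mul_geomSeries a)
  rw [Derivation.leibniz, smul_eq_mul, smul_eq_mul, derivative_one_add_mul,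
    Derivation.map_one_eq_zero] at h
  linear_combination geomSeries a * h - (PowerSeries.derivative ℝ (geomSeries a) +
    geomSeries a * (PowerSeries.C a * geomSeries a)) * one_add_mul_geomSeries a

theorem derivative_prod_of_logDeriv {ι : Type*} (S : Finset ι) {f q : ι → PowerSeries ℝ}
    (h : ∀ i, PowerSeries.derivative ℝ (f i) = f i * q i) :
    PowerSeries.derivative ℝ (∏ i ∈ S, f i) = (∏ i ∈ S, f i) * ∑ i ∈ S, q i := by
  classical
  induction S using Finset.induction_on with
  | empty => simp
  | insert i S hi ih =>
    rw [prod_insert hi, sum_insert hi, Derivation.leibniz, ih, h, smul_eq_mul, smul_eq_mul]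
    ring

theorem prod_one_add_mul_prod_geomSeries {ι : Type*} (S : Finset ι) (t : ι → ℝ) :
    (∏ i ∈ S, (1 + PowerSeries.C (t i) * PowerSeries.X)) * ∏ i ∈ S, geomSeries (t i) = 1 := by
  rw [← prod_mul_distrib]
  exact prod_eq_one fun i _ => one_add_mul_geomSeries _

/-- Newton's identities for the moments of a discrete measure: its generating function is the
rational function `∏ (1 + sᵢ X) / (1 + tᵢ X)`, and the logarithmic derivative produces the
differences of power sums. -/
theorem sum_pow_sub_sum_pow_eq_newtonSum {ι : Type*} [Fintype ι] [DecidableEq ι]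
    {t m s : ι → ℝ} (hsum : ∑ i, m i = 1)
    (h : stieltjesNumerator t m = ∏ i, (1 + Polynomial.C (s i) * Polynomial.X)) (n : ℕ) :
    ∑ i, t i ^ (n + 1) - ∑ i, s i ^ (n + 1) = newtonSum (fun k => ∑ i, m i * t i ^ k) n := by
  refine eq_newtonSum (b := fun k => ∑ i, m i * t i ^ k)
    (T := fun n => ∑ i, t i ^ (n + 1) - ∑ i, s i ^ (n + 1)) (by simpa using hsum) (fun n => ?_) n
  have hP : ∑ i, PowerSeries.C (m i) * geomSeries (t i) =
      (∏ i, (1 + PowerSeries.C (s i) * PowerSeries.X)) * ∏ i, geomSeries (t i) := by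
    have h' := congrArg (fun p : ℝ[X] => (p : PowerSeries ℝ)) h
    simp only [stieltjesNumerator] at h'
    have e1 : ∀ (S : Finset ι) (t : ι → ℝ),
        ((∏ i ∈ S, (1 + Polynomial.C (t i) * Polynomial.X) : ℝ[X]) : PowerSeries ℝ) =
          ∏ i ∈ S, (1 + PowerSeries.C (t i) * PowerSeries.X) := fun S t => by
      rw [← Polynomial.coeToPowerSeries.ringHom_apply, map_prod]
      simp
    rw [e1, ← Polynomial.coeToPowerSeries.ringHom_apply, map_sum] at h'
    rw [← h', sum_mul]
    refine sum_congr rfl fun i _ => ?_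
    rw [map_mul, Polynomial.coeToPowerSeries.ringHom_apply,
      Polynomial.coeToPowerSeries.ringHom_apply, e1, Polynomial.coe_C,
      ← mul_prod_erase univ _ (mem_univ i)]
    linear_combination (-PowerSeries.C (m i) * geomSeries (t i)) *
      prod_one_add_mul_prod_geomSeries (univ.erase i) t
  have hD : PowerSeries.derivative ℝ (∑ i, PowerSeries.C (m i) * geomSeries (t i)) =
      (∑ i, PowerSeries.C (m i) * geomSeries (t i)) *
        (∑ i, PowerSeries.C (s i) * geomSeries (s i) -
          ∑ i, PowerSeries.C (t i) * geomSeries (t i)) := by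
    rw [hP, Derivation.leibniz, derivative_prod_of_logDeriv _ fun i => derivative_one_add_mul (s i),
      derivative_prod_of_logDeriv _ fun i => derivative_geomSeries (t i), smul_eq_mul, smul_eq_mul,
      sum_neg_distrib]
    ring
  have hc := congrArg (PowerSeries.coeff n) hD
  rw [PowerSeries.coeff_derivative, mul_comm (∑ i, PowerSeries.C (m i) * _),
    PowerSeries.coeff_mul, Finset.Nat.sum_antidiagonal_eq_sum_range_succ_mk] at hc
  simp only [map_sum, map_sub, PowerSeries.coeff_C_mul, geomSeries, PowerSeries.coeff_mk] at hc
  have e2 : ∀ (c : ι → ℝ) (k : ℕ), ∑ i, c i * (-t i) ^ k = (-1) ^ k * ∑ i, c i * t i ^ k :=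
    fun c k => by
      rw [mul_sum]; exact sum_congr rfl fun i _ => by rw [neg_pow]; ring
  have e3 : ∀ (c : ι → ℝ) (k : ℕ), ∑ i, c i * (-c i) ^ k = (-1) ^ k * ∑ i, c i ^ (k + 1) :=
    fun c k => by
      rw [mul_sum]; exact sum_congr rfl fun i _ => by rw [neg_pow]; ring
  simp only [e3, e2] at hc
  have e4 : ∀ k ∈ range (n + 1), ((-1 : ℝ) ^ k * ∑ i, s i ^ (k + 1) -
      (-1) ^ k * ∑ i, t i ^ (k + 1)) * ((-1) ^ (n - k) * ∑ i, m i * t i ^ (n - k)) =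
      (-1) ^ (n + 1) * ((∑ i, t i ^ (k + 1) - ∑ i, s i ^ (k + 1)) *
        ∑ i, m i * t i ^ (n - k)) := fun k hk => by
    have : (-1 : ℝ) ^ (n + 1) = -((-1) ^ k * (-1) ^ (n - k)) := by
      rw [← pow_add, Nat.add_sub_cancel' (mem_range_succ_iff.1 hk), pow_succ]; ring
    rw [this]; ring
  rw [sum_congr rfl e4, ← mul_sum] at hc
  have := mul_left_cancel₀ (pow_ne_zero (n + 1) (by norm_num : (-1 : ℝ) ≠ 0))
    (hc.symm.trans (by ring : _ = (-1 : ℝ) ^ (n + 1) * (((n : ℝ) + 1) * ∑ i, m i * t i ^ (n + 1))))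
  exact this

/-! ### The exponential representation in the discrete case -/

theorem integral_iUnion_Ioc_interlacing {E : Type*} [NormedAddCommGroup E] [NormedSpace ℝ E]
    {n : ℕ} {t s : Fin n → ℝ} (hs0 : ∀ i, 0 ≤ s i) (hst : ∀ i, s i < t i)
    (hts : ∀ i j, i < j → t i < s j) {f : ℝ → E} (hf : ContinuousOn f (Set.Ici 0)) :
    ∫ x in ⋃ i, Set.Ioc (s i) (t i), f x = ∑ i, ∫ x in (s i)..(t i), f x := by
  rw [MeasureTheory.integral_iUnion_fintype (fun i => measurableSet_Ioc)]
  · exact sum_congr rfl fun i _ => (intervalIntegral.integral_of_le (hst i).le).symm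
  · have key : ∀ i j, i < j → Disjoint (Set.Ioc (s i) (t i)) (Set.Ioc (s j) (t j)) :=
      fun i j h => Set.disjoint_left.2 fun x hx hx' => (hx.2.trans_lt (hts i j h)).not_gt hx'.1
    intro i j hij
    rcases lt_or_gt_of_ne hij with h | h
    · exact key i j h
    · exact (key j i h).symm
  · intro i
    refine (ContinuousOn.integrableOn_Icc ?_).mono_set Set.Ioc_subset_Icc_self
    exact hf.mono fun x hx => (hs0 i).trans hx.1

theorem add_ofReal_mem_slitPlane {w : ℂ} (hw : w.im ≠ 0) (x : ℝ) : w + x ∈ Complex.slitPlane :=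
  Complex.mem_slitPlane_iff.2 (Or.inr (by simpa using hw))

theorem continuous_one_div_add {w : ℂ} (hw : w.im ≠ 0) :
    Continuous fun x : ℝ => 1 / (w + x) :=
  continuous_const.div (continuous_const.add Complex.continuous_ofReal)
    fun x => Complex.slitPlane_ne_zero (add_ofReal_mem_slitPlane hw x)

theorem integral_one_div_add {w : ℂ} (hw : w.im ≠ 0) (a b : ℝ) :
    ∫ x in a..b, 1 / (w + (x : ℂ)) = Complex.log (w + b) - Complex.log (w + a) := by
  refine intervalIntegral.integral_eq_sub_of_hasDerivAt (f := fun x : ℝ => Complex.log (w + x))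
    (fun x _ => ?_) ((continuous_one_div_add hw).intervalIntegrable _ _)
  have h : HasDerivAt (fun y : ℝ => (y : ℂ)) 1 x := by simpa using (hasDerivAt_id x).ofReal_comp
  exact (h.const_add w).clog_real (add_ofReal_mem_slitPlane hw x)

theorem im_one_div_add (w : ℂ) (x : ℝ) :
    (1 / (w + (x : ℂ))).im = -w.im / Complex.normSq (w + x) := by
  simp [Complex.inv_im]

/-- The integral of `1 / (w + x)` over a part of `(0, B]` stays in the strip `|Im| < π`: over all
of `(0, B]` the imaginary part is `arg (w + B) - arg w`. -/
theorem im_setIntegral_one_div_add_mem {w : ℂ} (hw : w.im < 0) {A : Set ℝ} {B : ℝ}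
    (hAB : A ⊆ Set.Ioc 0 B) :
    0 ≤ (∫ x in A, 1 / (w + (x : ℂ))).im ∧ (∫ x in A, 1 / (w + (x : ℂ))).im < Real.pi := by
  have hint : MeasureTheory.IntegrableOn (fun x : ℝ => 1 / (w + (x : ℂ))) (Set.Ioc 0 B) :=
    (continuous_one_div_add hw.ne).integrableOn_Ioc
  have him : ∀ S ⊆ Set.Ioc 0 B, (∫ x in S, 1 / (w + (x : ℂ))).im =
      ∫ x in S, (1 / (w + (x : ℂ))).im := fun S hS =>
    (integral_im (𝕜 := ℂ) (hint.mono_set hS)).symm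
  have hnn : ∀ x : ℝ, 0 ≤ (1 / (w + (x : ℂ))).im := fun x => by
    rw [im_one_div_add]; exact div_nonneg (by linarith) (Complex.normSq_nonneg _)
  constructor
  · rw [him A hAB]
    exact MeasureTheory.integral_nonneg hnn
  · have h1 : (∫ x in A, 1 / (w + (x : ℂ))).im ≤ (∫ x in Set.Ioc 0 B, 1 / (w + (x : ℂ))).im := by
      rw [him A hAB, him _ subset_rfl]
      exact MeasureTheory.setIntegral_mono_set hint.im
        (Filter.Eventually.of_forall hnn) hAB.eventuallyLE
    rcases le_or_gt B 0 with hB | hB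
    · rw [Set.Ioc_eq_empty hB.not_gt] at h1
      simp only [MeasureTheory.Measure.restrict_empty, MeasureTheory.integral_zero_measure] at h1
      exact h1.trans_lt Real.pi_pos
    · rw [← intervalIntegral.integral_of_le hB.le, integral_one_div_add hw.ne] at h1
      simp only [Complex.sub_im, Complex.log_im, Complex.ofReal_zero, add_zero] at h1
      have h2 : (w + B).arg < 0 := Complex.arg_neg_iff.2 (by simpa using hw)
      linarith [Complex.neg_pi_lt_arg w]

/-- A discrete version of the exponential representation of Stieltjes transforms of probability
measures on `(0, ∞)`: `∑ mᵢ w / (w + tᵢ) = exp (-∫_A dx / (w + x))` for a bounded set `A` of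
positive numbers, whose moments are determined by those of the measure. -/
theorem exists_set_of_discrete {ι : Type*} [Fintype ι] {t m : ι → ℝ}
    (ht : Function.Injective t) (ht0 : ∀ i, 0 < t i) (hm : ∀ i, 0 < m i) (hsum : ∑ i, m i = 1) :
    ∃ (A : Set ℝ) (B : ℝ), MeasurableSet A ∧ A ⊆ Set.Ioc 0 B ∧
      (∀ n : ℕ, ((n : ℝ) + 1) * ∫ x in A, x ^ n = newtonSum (fun k => ∑ i, m i * t i ^ k) n) ∧
      ∀ w : ℂ, w.im < 0 →
        Complex.log (∑ i, m i * (w / (w + t i))) = -∫ x in A, 1 / (w + (x : ℂ)) ∧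
        Complex.log (∑ i, m i * (-w / (-w + t i))) = -∫ x in A, 1 / (-w + (x : ℂ)) := by
  classical
  have hne : Nonempty ι := by
    by_contra h
    rw [not_nonempty_iff] at h
    simp at hsum
  obtain ⟨n, hn⟩ : ∃ n, Fintype.card ι = n + 1 :=
    Nat.exists_eq_succ_of_ne_zero Fintype.card_ne_zero
  obtain ⟨e, he⟩ : ∃ e : Fin (n + 1) ≃ ι, StrictMono (t ∘ e) := by
    let e := (Fintype.equivFinOfCardEq hn).symm
    refine ⟨(Tuple.sort (t ∘ e)).trans e, Monotone.strictMono_of_injective ?_ ?_⟩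
    · exact Tuple.monotone_sort (t ∘ e)
    · exact ht.comp (Equiv.injective _)
  obtain ⟨s, hs0, hst, hts, hpoly⟩ := exists_interlacing (m := m ∘ e) he (fun i => ht0 _)
    (fun i => hm _) (by simpa using (Equiv.sum_comp e m).trans hsum)
  set A : Set ℝ := ⋃ i, Set.Ioc (s i) ((t ∘ e) i) with hAdef
  have hA : MeasurableSet A := MeasurableSet.iUnion fun i => measurableSet_Ioc
  have hAB : A ⊆ Set.Ioc 0 (∑ i, (t ∘ e) i) := by
    refine Set.iUnion_subset fun i x hx => ⟨(hs0 i).trans_lt hx.1, hx.2.trans ?_⟩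
    exact single_le_sum (fun j _ => (ht0 (e j)).le) (mem_univ i)
  have hexp : ∀ w : ℂ, w.im ≠ 0 →
      Complex.exp (-∫ x in A, 1 / (w + (x : ℂ))) = ∑ i, m i * (w / (w + t i)) := by
    intro w hw
    have hw0 : w ≠ 0 := fun h => hw (by simp [h])
    have hz : ∀ x : ℝ, w + x ≠ 0 := fun x =>
      Complex.slitPlane_ne_zero (add_ofReal_mem_slitPlane hw x)
    have hz' : ∀ x : ℝ, 1 + x * w⁻¹ ≠ 0 := fun x h => hz x (by
      have := congrArg (· * w) h
      simp only [add_mul, zero_mul, mul_assoc, inv_mul_cancel₀ hw0] at this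
      linear_combination this)
    have h1 := congrArg (Polynomial.aeval (w⁻¹)) hpoly
    rw [stieltjesNumerator, map_sum, map_prod] at h1
    simp only [map_mul, map_prod, map_add, map_one, Polynomial.aeval_C, Polynomial.aeval_X,
      Complex.coe_algebraMap] at h1
    have h2 : ∑ i, m i * (w / (w + t i)) =
        (∏ i, (1 + (s i : ℂ) * w⁻¹)) / ∏ i, (1 + ((t ∘ e) i : ℂ) * w⁻¹) := by
      rw [← h1, ← Equiv.sum_comp e, sum_div]
      refine sum_congr rfl fun i _ => ?_
      rw [← mul_prod_erase univ _ (mem_univ i)]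
      have h3 : ∏ j ∈ univ.erase i, (1 + ((t ∘ e) j : ℂ) * w⁻¹) ≠ 0 :=
        prod_ne_zero_iff.2 fun j _ => hz' _
      rw [mul_div_mul_right _ _ h3]
      have h4 := hz (t (e i))
      have h5 := hz' (t (e i))
      simp only [Function.comp]
      rw [mul_div_assoc']
      rw [div_eq_div_iff h4 h5]
      field_simp
    rw [h2, integral_iUnion_Ioc_interlacing hs0 hst hts (continuous_one_div_add hw).continuousOn,
      ← sum_neg_distrib, Complex.exp_sum, ← prod_div_distrib]
    refine prod_congr rfl fun i _ => ?_
    rw [integral_one_div_add hw, neg_sub, Complex.exp_sub, Complex.exp_log (hz _),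
      Complex.exp_log (hz _), div_eq_div_iff (hz _) (hz' _)]
    field_simp
  refine ⟨A, _, hA, hAB, fun n => ?_, fun w hw => ?_⟩
  · have h1 := sum_pow_sub_sum_pow_eq_newtonSum
      (by simpa using (Equiv.sum_comp e m).trans hsum) hpoly n
    have h2 : (fun k => ∑ i, (m ∘ e) i * (t ∘ e) i ^ k) = fun k => ∑ i, m i * t i ^ k :=
      funext fun k => Equiv.sum_comp e fun i => m i * t i ^ k
    rw [h2] at h1
    rw [← h1, integral_iUnion_Ioc_interlacing hs0 hst hts (by fun_prop), mul_sum,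
      ← sum_sub_distrib]
    refine sum_congr rfl fun i _ => ?_
    rw [integral_pow]
    field_simp
  -- The exponentials agree, and the bound on the imaginary part selects the principal logarithm.
  · have hb := im_setIntegral_one_div_add_mem hw hAB
    have hconj : ∫ x in A, 1 / (-w + (x : ℂ)) =
        starRingEnd ℂ (∫ x in A, 1 / (starRingEnd ℂ (-w) + (x : ℂ))) := by
      rw [← integral_conj]
      simp
    have hb' : (∫ x in A, 1 / (-w + (x : ℂ))).im ≤ 0 ∧
        -Real.pi < (∫ x in A, 1 / (-w + (x : ℂ))).im := by
      have h := im_setIntegral_one_div_add_mem (w := starRingEnd ℂ (-w)) (by simpa using hw) hAB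
      rw [hconj, Complex.conj_im]
      constructor <;> linarith [h.1, h.2]
    constructor
    · rw [← hexp w hw.ne, Complex.log_exp] <;> rw [Complex.neg_im] <;>
        linarith [hb.1, hb.2, Real.pi_pos]
    · have := hexp (-w) (by simpa using hw.ne)
      rw [← this, Complex.log_exp] <;> rw [Complex.neg_im] <;>
        linarith [hb'.1, hb'.2, Real.pi_pos]

open MeasureTheory Filter Topology

/-! ### Approximation by discrete measures -/

/-- The transform `w ↦ w ∫ dm(t) / (w + t)` of a measure `m` on `(0, ∞)`, that is, `w` times its
Stieltjes transform. It is defined off `(-∞, 0]` and tends to the mass of `m` at infinity. -/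
noncomputable def stieltjes (m : Measure ℝ) (w : ℂ) : ℂ := ∫ t, w / (w + (t : ℂ)) ∂m

theorem im_div_add (w : ℂ) (t : ℝ) :
    (w / (w + (t : ℂ))).im = t * w.im / Complex.normSq (w + t) := by
  rw [Complex.div_im]
  simp only [Complex.add_re, Complex.add_im, Complex.ofReal_re, Complex.ofReal_im]
  ring

theorem norm_div_add_le {w : ℂ} (hw : w.im ≠ 0) (t : ℝ) :
    ‖w / (w + (t : ℂ))‖ ≤ ‖w‖ / |w.im| := by
  rw [norm_div]
  gcongr
  · simpa using Complex.abs_im_le_norm (w + t)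

theorem continuous_div_add {w : ℂ} (hw : w.im ≠ 0) : Continuous fun t : ℝ => w / (w + (t : ℂ)) :=
  continuous_const.div (continuous_const.add Complex.continuous_ofReal)
    fun x => Complex.slitPlane_ne_zero (add_ofReal_mem_slitPlane hw x)

theorem integrable_div_add (m : Measure ℝ) [IsFiniteMeasure m] {w : ℂ} (hw : w.im ≠ 0) :
    Integrable (fun t : ℝ => w / (w + (t : ℂ))) m :=
  Integrable.of_bound (continuous_div_add hw).aestronglyMeasurable _
    (Eventually.of_forall (norm_div_add_le hw))

/-- The transform preserves the open upper and lower half-planes. -/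
theorem im_mul_im_stieltjes_pos {m : Measure ℝ} [IsProbabilityMeasure m]
    (hm : ∀ᵐ t ∂m, 0 < t) {w : ℂ} (hw : w.im ≠ 0) : 0 < w.im * (stieltjes m w).im := by
  have h1 : w.im * (stieltjes m w).im = ∫ t, w.im * (w / (w + (t : ℂ))).im ∂m := by
    rw [integral_const_mul]
    congr 1
    exact (integral_im (𝕜 := ℂ) (integrable_div_add m hw)).symm
  have hpos : ∀ᵐ t : ℝ ∂m, 0 < w.im * (w / (w + (t : ℂ))).im := by
    filter_upwards [hm] with t ht
    rw [im_div_add, show w.im * (t * w.im / Complex.normSq (w + t)) =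
      t * (w.im * w.im) / Complex.normSq (w + t) by ring]
    exact div_pos (mul_pos ht (mul_self_pos.2 hw)) (Complex.normSq_pos.2
      (Complex.slitPlane_ne_zero (add_ofReal_mem_slitPlane hw t)))
  have hnn : 0 ≤ᵐ[m] fun t : ℝ => w.im * (w / (w + (t : ℂ))).im := hpos.mono fun t ht => ht.le
  rw [h1]
  refine lt_of_le_of_ne (integral_nonneg_of_ae hnn) fun h0 => ?_
  have := (integral_eq_zero_iff_of_nonneg_ae hnn
    ((integrable_div_add m hw).im.const_mul _)).1 h0.symm
  obtain ⟨t, ht, ht'⟩ := (hpos.and this).exists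
  exact ht.ne' ht'

theorem stieltjes_mem_slitPlane {m : Measure ℝ} [IsProbabilityMeasure m]
    (hm : ∀ᵐ t ∂m, 0 < t) {w : ℂ} (hw : w.im ≠ 0) : stieltjes m w ∈ Complex.slitPlane :=
  Complex.mem_slitPlane_iff.2 (Or.inr (right_ne_zero_of_mul (im_mul_im_stieltjes_pos hm hw).ne'))

/-- The analytic continuation to `Re z > 0` of the argument of `∫ z / (z + i t) dm(t)`, `z > 0`:
the complex conjugate, which is not analytic, is replaced by `∫ z / (z - i t) dm(t)`. Principal
logarithms suffice since the two transforms stay in open half-planes. -/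
noncomputable def stieltjesPhase (m : Measure ℝ) (z : ℂ) : ℂ :=
  (Complex.log (stieltjes m (-(Complex.I * z))) - Complex.log (stieltjes m (Complex.I * z))) /
    (2 * Complex.I)

/-- Points of the convex hull of the curve `t ↦ (1, t, …, t ^ K, w / (w + t), -w / (-w + t))`
are represented by discrete measures with distinct atoms (Carathéodory's theorem). -/
theorem exists_set_of_mem_convexHull {K : ℕ} {w : ℂ} (hw : w.im < 0)
    {y : (Fin (K + 1) → ℝ) × ℂ × ℂ}
    (hy : y ∈ convexHull ℝ ((fun t : ℝ => ((fun j : Fin (K + 1) => t ^ (j : ℕ)),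
      w / (w + (t : ℂ)), -w / (-w + (t : ℂ)))) '' Set.Ioi 0)) :
    ∃ (A : Set ℝ) (B : ℝ) (b : ℕ → ℝ), MeasurableSet A ∧ A ⊆ Set.Ioc 0 B ∧
      (∀ j : Fin (K + 1), b j = y.1 j) ∧
      (∀ n : ℕ, ((n : ℝ) + 1) * ∫ x in A, x ^ n = newtonSum b n) ∧
      Complex.log y.2.1 = -∫ x in A, 1 / (w + (x : ℂ)) ∧
      Complex.log y.2.2 = -∫ x in A, 1 / (-w + (x : ℂ)) := by
  obtain ⟨ι, _, p, c, hp, hind, hc, hsum, rfl⟩ := eq_pos_convex_span_of_mem_convexHull hy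
  choose t ht0 htp using fun i => hp ⟨i, rfl⟩
  have htinj : Function.Injective t := fun i j h => hind.injective (by rw [← htp i, ← htp j, h])
  obtain ⟨A, B, hA, hAB, hmom, hlog⟩ := exists_set_of_discrete htinj ht0 hc hsum
  refine ⟨A, B, _, hA, hAB, fun j => ?_, hmom, ?_, ?_⟩
  · simp [← htp, Prod.fst_sum, Finset.sum_apply]
  · rw [← (hlog w hw).1]
    simp [← htp, Prod.fst_sum, Prod.snd_sum]
  · rw [← (hlog w hw).2]
    simp [← htp, Prod.snd_sum]

theorem integral_mem_closure_convexHull {E : Type*} [NormedAddCommGroup E] [NormedSpace ℝ E]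
    [CompleteSpace E] {m : Measure ℝ} [IsProbabilityMeasure m] (hm : ∀ᵐ t ∂m, 0 < t) {g : ℝ → E}
    (hg : Integrable g m) : ∫ t, g t ∂m ∈ closure (convexHull ℝ (g '' Set.Ioi 0)) :=
  (convex_convexHull ℝ _).closure.integral_mem isClosed_closure
    (hm.mono fun t ht => subset_closure (subset_convexHull ℝ _ ⟨t, ht, rfl⟩)) hg

theorem setIntegral_div_sq_add_sq {z : ℂ} (hz : 0 < z.re) {A : Set ℝ} {B : ℝ}
    (hAB : A ⊆ Set.Ioc 0 B) :
    ∫ x in A, z / (z ^ 2 + (x : ℂ) ^ 2) =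
      -(((-∫ x in A, 1 / (-(Complex.I * z) + (x : ℂ))) -
        (-∫ x in A, 1 / (- -(Complex.I * z) + (x : ℂ)))) / (2 * Complex.I)) := by
  have hw : (-(Complex.I * z)).im ≠ 0 := by simpa using hz.ne'
  have hw' : (- -(Complex.I * z)).im ≠ 0 := by simpa using hz.ne'
  have hi : ∀ {w : ℂ}, w.im ≠ 0 → IntegrableOn (fun x : ℝ => 1 / (w + (x : ℂ))) A := fun hw =>
    ((continuous_one_div_add hw).integrableOn_Ioc (a := 0) (b := B)).mono_set hAB
  rw [neg_sub_neg, ← integral_sub (hi hw') (hi hw), ← integral_div, ← integral_neg]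
  refine integral_congr_ae (Eventually.of_forall fun x => ?_)
  have h1 := Complex.slitPlane_ne_zero (add_ofReal_mem_slitPlane hw x)
  have h2 := Complex.slitPlane_ne_zero (add_ofReal_mem_slitPlane hw' x)
  have h3 : z ^ 2 + (x : ℂ) ^ 2 =
      (-(Complex.I * z) + (x : ℂ)) * (- -(Complex.I * z) + (x : ℂ)) := by
    linear_combination z ^ 2 * Complex.I_sq
  have hI := Complex.I_ne_zero
  simp only [h3]
  generalize hp : -(Complex.I * z) + (x : ℂ) = p at *
  generalize hq : - -(Complex.I * z) + (x : ℂ) = q at *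
  have hz' : z = (q - p) / (2 * Complex.I) := by
    rw [← hp, ← hq]
    field_simp
    ring
  rw [hz']
  field_simp
  ring

/-- Approximation of `m` by discrete measures: the moments and the phase of `m` are limits of
`∫_A x ^ n dx` and `-∫_A z / (z ^ 2 + x ^ 2) dx` for bounded sets `A` of positive numbers. -/
theorem exists_seq_set {m : Measure ℝ} [IsProbabilityMeasure m] (hm : ∀ᵐ t ∂m, 0 < t)
    (hint : ∀ n : ℕ, Integrable (fun t => t ^ n) m) {z : ℂ} (hz : 0 < z.re) (K : ℕ) :
    ∃ A : ℕ → Set ℝ, (∀ k, MeasurableSet (A k)) ∧ (∀ k, ∃ B, A k ⊆ Set.Ioc 0 B) ∧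
      (∀ n < K, Tendsto (fun k => ∫ x in A k, x ^ n) atTop
        (𝓝 (newtonSum (fun j => ∫ t, t ^ j ∂m) n / (n + 1)))) ∧
      Tendsto (fun k => ∫ x in A k, z / (z ^ 2 + (x : ℂ) ^ 2)) atTop
        (𝓝 (-stieltjesPhase m z)) := by
  set w := -(Complex.I * z) with hwdef
  have hw : w.im < 0 := by simpa [hwdef] using hz
  have hw' : (-w).im ≠ 0 := by simpa using hw.ne
  set g : ℝ → (Fin (K + 1) → ℝ) × ℂ × ℂ := fun t : ℝ => ((fun j : Fin (K + 1) => t ^ (j : ℕ)),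
      w / (w + (t : ℂ)), -w / (-w + (t : ℂ))) with hgdef
  have h1 : Integrable (fun t : ℝ => (fun j : Fin (K + 1) => t ^ (j : ℕ))) m :=
    Integrable.of_eval fun j => hint j
  have h2 := integrable_div_add m hw.ne
  have h3 := integrable_div_add m hw'
  have hg : Integrable g m := h1.prodMk (h2.prodMk h3)
  obtain ⟨u, hu, hlim⟩ := mem_closure_iff_seq_limit.1 (integral_mem_closure_convexHull hm hg)
  choose A B b hA hAB hb hmom hlog1 hlog2 using fun k => exists_set_of_mem_convexHull hw (hu k)
  have hi1 : (∫ t, g t ∂m).1 = fun j : Fin (K + 1) => ∫ t, t ^ (j : ℕ) ∂m := by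
    rw [fst_integral hg]
    ext j
    exact eval_integral (f := fun (t : ℝ) (j : Fin (K + 1)) => t ^ (j : ℕ)) (fun i => hint i) j
  have hi2 : (∫ t, g t ∂m).2 = (stieltjes m w, stieltjes m (-w)) := by
    rw [snd_integral hg]
    exact integral_pair h2 h3
  refine ⟨A, hA, fun k => ⟨B k, hAB k⟩, fun n hn => ?_, ?_⟩
  · have : ∀ k, ∫ x in A k, x ^ n = newtonSum (b k) n / (n + 1) := fun k => by
      rw [← hmom, mul_div_cancel_left₀ _ (by positivity)]
    simp_rw [this]
    refine (tendsto_newtonSum n fun j hj => ?_).div_const _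
    have hj' : j < K + 1 := by omega
    have hb' : ∀ k, b k j = (u k).1 ⟨j, hj'⟩ := fun k => hb k ⟨j, hj'⟩
    simp_rw [hb']
    have := (tendsto_pi_nhds.1 ((continuous_fst.tendsto _).comp hlim)) ⟨j, hj'⟩
    rw [hi1] at this
    exact this
  · have h4 : ∀ k, ∫ x in A k, z / (z ^ 2 + (x : ℂ) ^ 2) =
        -((Complex.log (u k).2.1 - Complex.log (u k).2.2) / (2 * Complex.I)) := fun k => by
      rw [setIntegral_div_sq_add_sq hz (hAB k), hlog1, hlog2]
    simp_rw [h4]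
    have h5 := (continuous_snd.tendsto _).comp hlim
    rw [hi2] at h5
    have h6 : Tendsto (fun k => (u k).2.1) atTop (𝓝 (stieltjes m w)) :=
      (continuous_fst.tendsto _).comp h5
    have h7 : Tendsto (fun k => (u k).2.2) atTop (𝓝 (stieltjes m (-w))) :=
      (continuous_snd.tendsto _).comp h5
    have h8 := (h6.clog (stieltjes_mem_slitPlane hm hw.ne)).sub
      (h7.clog (stieltjes_mem_slitPlane hm hw'))
    have h9 : stieltjesPhase m z = (Complex.log (stieltjes m w) - Complex.log (stieltjes m (-w))) /
      (2 * Complex.I) := by rw [stieltjesPhase, hwdef, neg_neg]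
    rw [h9]
    exact (h8.div_const _).neg

/-! ### Remainder estimates -/

/-- If `|arg z| ≤ π / 4` then `Re z² ≥ 0` and `|z² + x²| ≥ |z|²`; otherwise
`|z² + x²| ≥ |Im z²| = |z|² |sin (2 arg z)|` is used. -/
theorem norm_inv_sq_add_sq_le {z : ℂ} (hz : 0 < z.re) (x : ℝ) :
    ‖(z ^ 2 + (x : ℂ) ^ 2)⁻¹‖ ≤ phaseErrorFactor z.arg / ‖z‖ ^ 2 := by
  have hz0 : z ≠ 0 := fun h => by simp [h] at hz
  have hn : 0 < ‖z‖ := norm_pos_iff.2 hz0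
  have hre : (z ^ 2).re = ‖z‖ ^ 2 * Real.cos (2 * z.arg) := by
    rw [Real.cos_two_mul]
    have h1 := Complex.norm_mul_cos_arg z
    have h2 := Complex.sq_norm_sub_sq_re z
    have h3 : (z ^ 2).re = z.re ^ 2 - z.im ^ 2 := by simp [pow_two]
    rw [h3, ← h2, ← h1]
    ring
  have him : (z ^ 2).im = ‖z‖ ^ 2 * Real.sin (2 * z.arg) := by
    rw [Real.sin_two_mul]
    have h1 := Complex.norm_mul_cos_arg z
    have h2 := Complex.norm_mul_sin_arg z
    have h3 : (z ^ 2).im = 2 * z.re * z.im := by simp [pow_two]; ring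
    rw [h3]
    rw [← h1, ← h2]
    ring
  have hx2 : ((x : ℂ) ^ 2) = ((x ^ 2 : ℝ) : ℂ) := by push_cast; rfl
  have harg := Complex.abs_arg_lt_pi_div_two_iff.2 (Or.inl hz)
  rw [norm_inv, phaseErrorFactor]
  split_ifs with h
  · rw [one_div]
    refine inv_anti₀ (by positivity) ?_
    have hcos : 0 ≤ Real.cos (2 * z.arg) := by
      refine Real.cos_nonneg_of_neg_pi_div_two_le_of_le ?_ ?_ <;>
        linarith [(abs_le.1 h).1, (abs_le.1 h).2]
    have hre0 : 0 ≤ (z ^ 2).re := by rw [hre]; positivity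
    rw [← norm_pow, hx2]
    refine (sq_le_sq₀ (norm_nonneg _) (norm_nonneg _)).1 ?_
    rw [Complex.sq_norm, Complex.sq_norm, Complex.normSq_apply, Complex.normSq_apply,
      Complex.add_re, Complex.add_im, Complex.ofReal_re, Complex.ofReal_im, add_zero]
    nlinarith [mul_nonneg hre0 (sq_nonneg x), sq_nonneg (x ^ 2)]
  · have hsin : Real.sin (2 * z.arg) ≠ 0 := by
      rw [not_le] at h
      rcases lt_or_ge 0 z.arg with h0 | h0
      · rw [abs_of_pos h0] at h harg
        exact (Real.sin_pos_of_pos_of_lt_pi (by linarith) (by linarith)).ne'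
      · rw [abs_of_nonpos h0] at h harg
        exact (Real.sin_neg_of_neg_of_neg_pi_lt (by linarith [Real.pi_pos]) (by linarith)).ne
    have h1 : ‖z‖ ^ 2 * |Real.sin (2 * z.arg)| ≤ ‖z ^ 2 + (x : ℂ) ^ 2‖ := by
      have := Complex.abs_im_le_norm (z ^ 2 + (x : ℂ) ^ 2)
      rw [hx2, Complex.add_im, Complex.ofReal_im, add_zero, him, abs_mul,
        abs_of_nonneg (by positivity)] at this
      rwa [hx2]
    have h2 := abs_pos.2 hsin
    rw [abs_inv, div_eq_mul_inv, ← mul_inv, mul_comm]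
    exact inv_anti₀ (by positivity) h1

theorem sq_add_sq_ne_zero {z : ℂ} (hz : 0 < z.re) (x : ℝ) : z ^ 2 + (x : ℂ) ^ 2 ≠ 0 := by
  intro h
  have h1 : (z - Complex.I * x) * (z + Complex.I * x) = 0 := by
    linear_combination h - x ^ 2 * Complex.I_sq
  rcases mul_eq_zero.1 h1 with h | h <;>
  · have := congrArg Complex.re h
    simp at this
    exact hz.ne' this

theorem continuous_inv_sq_add_sq {z : ℂ} (hz : 0 < z.re) :
    Continuous fun x : ℝ => (z ^ 2 + (x : ℂ) ^ 2)⁻¹ :=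
  Continuous.inv₀ (by fun_prop) (sq_add_sq_ne_zero hz)

/-- The remainder after `N` terms of the geometric expansion, integrated over `A`. -/
theorem setIntegral_div_sq_add_sq_sub_sum {z : ℂ} (hz : 0 < z.re) {A : Set ℝ} {B : ℝ}
    (hAB : A ⊆ Set.Ioc 0 B) (N : ℕ) :
    (∫ x in A, z / (z ^ 2 + (x : ℂ) ^ 2)) -
      ∑ n ∈ range N, (-1 : ℂ) ^ n * ((∫ x in A, x ^ (2 * n) : ℝ) : ℂ) * (1 / z ^ (2 * n + 1)) =
    (-1) ^ N * (z / z ^ (2 * N)) * ∫ x in A, (x : ℂ) ^ (2 * N) * (z ^ 2 + (x : ℂ) ^ 2)⁻¹ := by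
  have hz0 : z ≠ 0 := fun h => by simp [h] at hz
  have hc := continuous_inv_sq_add_sq hz
  have hi : ∀ n : ℕ, IntegrableOn (fun x : ℝ => (x : ℂ) ^ n * (z ^ 2 + (x : ℂ) ^ 2)⁻¹) A :=
    fun n => (Continuous.integrableOn_Ioc (a := 0) (b := B)
      ((Complex.continuous_ofReal.pow n).mul hc)).mono_set hAB
  have hi' : ∀ n : ℕ, IntegrableOn (fun x : ℝ => (x : ℂ) ^ n) A :=
    fun n => (Continuous.integrableOn_Ioc (a := 0) (b := B)
      (Complex.continuous_ofReal.pow n)).mono_set hAB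
  induction N with
  | zero =>
    simp only [range_zero, sum_empty, sub_zero, pow_zero, mul_zero, one_mul, div_eq_mul_inv,
      integral_const_mul, inv_one, mul_one]
  | succ N ih =>
    have h1 : ((∫ x in A, x ^ (2 * N) : ℝ) : ℂ) =
        z ^ 2 * (∫ x in A, (x : ℂ) ^ (2 * N) * (z ^ 2 + (x : ℂ) ^ 2)⁻¹) +
          ∫ x in A, (x : ℂ) ^ (2 * (N + 1)) * (z ^ 2 + (x : ℂ) ^ 2)⁻¹ := by
      rw [← integral_const_mul, ← integral_add ((hi _).const_mul _) (hi _), ← integral_complex_ofReal]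
      refine integral_congr_ae (Eventually.of_forall fun x => ?_)
      have := sq_add_sq_ne_zero hz x
      simp only
      push_cast
      field_simp
      ring
    rw [sum_range_succ, ← sub_sub, ih, h1]
    field_simp
    ring

/-- The coefficients `c_n` in `stieltjesPhase m z ∼ -∑ (-1)^n c_{2n} / z^(2n+1)`. They are the
moments of the (not constructed) density that represents the phase. -/
noncomputable def phaseMoment (m : Measure ℝ) (n : ℕ) : ℝ :=
  newtonSum (fun j => ∫ t, t ^ j ∂m) n / (n + 1)

/-- The phase plus the first `N` terms of its expansion is a limit of the remainder integrals. -/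
theorem exists_seq_set_tendsto_remainder {m : Measure ℝ} [IsProbabilityMeasure m]
    (hm : ∀ᵐ t ∂m, 0 < t)
    (hint : ∀ n : ℕ, Integrable (fun t => t ^ n) m) {z : ℂ} (hz : 0 < z.re) (N : ℕ) :
    ∃ A : ℕ → Set ℝ, (∀ k, MeasurableSet (A k)) ∧ (∀ k, ∃ B, A k ⊆ Set.Ioc 0 B) ∧
      (∀ n < 2 * N + 3, Tendsto (fun k => ∫ x in A k, x ^ n) atTop (𝓝 (phaseMoment m n))) ∧
      Tendsto (fun k => (-1) ^ (N + 1) * (z / z ^ (2 * N)) *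
        ∫ x in A k, (x : ℂ) ^ (2 * N) * (z ^ 2 + (x : ℂ) ^ 2)⁻¹) atTop
        (𝓝 (stieltjesPhase m z + ∑ n ∈ range N,
          (-1 : ℂ) ^ n * (phaseMoment m (2 * n) : ℂ) * (1 / z ^ (2 * n + 1)))) := by
  obtain ⟨A, hA, hAB, hmom, hlim⟩ := exists_seq_set hm hint hz (2 * N + 3)
  refine ⟨A, hA, hAB, hmom, ?_⟩
  have h1 : ∀ k, (-1) ^ (N + 1) * (z / z ^ (2 * N)) *
      ∫ x in A k, (x : ℂ) ^ (2 * N) * (z ^ 2 + (x : ℂ) ^ 2)⁻¹ =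
      -(∫ x in A k, z / (z ^ 2 + (x : ℂ) ^ 2)) + ∑ n ∈ range N,
        (-1 : ℂ) ^ n * ((∫ x in A k, x ^ (2 * n) : ℝ) : ℂ) * (1 / z ^ (2 * n + 1)) := fun k => by
    obtain ⟨B, hB⟩ := hAB k
    linear_combination setIntegral_div_sq_add_sq_sub_sum hz hB N
  simp_rw [h1]
  have h2 := hlim.neg
  rw [neg_neg] at h2
  refine h2.add (tendsto_finsetSum _ fun n hn => ?_)
  have hn := mem_range.1 hn
  exact (((Complex.continuous_ofReal.tendsto _).comp (hmom (2 * n) (by omega))).const_mul _).mul_const _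

theorem stieltjesPhase_remainder_norm_le {m : Measure ℝ} [IsProbabilityMeasure m]
    (hm : ∀ᵐ t ∂m, 0 < t)
    (hint : ∀ n : ℕ, Integrable (fun t => t ^ n) m) {z : ℂ} (hz : 0 < z.re) (N : ℕ) :
    ‖stieltjesPhase m z + ∑ n ∈ range N,
          (-1 : ℂ) ^ n * (phaseMoment m (2 * n) : ℂ) * (1 / z ^ (2 * n + 1))‖ ≤
      phaseMoment m (2 * N) * (1 / ‖z‖ ^ (2 * N + 1)) * phaseErrorFactor z.arg := by
  obtain ⟨A, hA, hAB, hmom, hlim⟩ := exists_seq_set_tendsto_remainder hm hint hz N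
  refine le_of_tendsto_of_tendsto' hlim.norm
    (((hmom (2 * N) (by omega)).mul_const _).mul_const _) fun k => ?_
  obtain ⟨B, hB⟩ := hAB k
  have hz0 : z ≠ 0 := fun h => by simp [h] at hz
  have hn : 0 < ‖z‖ := norm_pos_iff.2 hz0
  have h1 : ‖∫ x in A k, (x : ℂ) ^ (2 * N) * (z ^ 2 + (x : ℂ) ^ 2)⁻¹‖ ≤
      ∫ x in A k, x ^ (2 * N) * (phaseErrorFactor z.arg / ‖z‖ ^ 2) := by
    refine norm_integral_le_of_norm_le ?_ (Eventually.of_forall fun x => ?_)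
    · exact (Continuous.integrableOn_Ioc (a := 0) (b := B) (by fun_prop)).mono_set hB
    · rw [norm_mul, norm_pow, Complex.norm_real, Real.norm_eq_abs, pow_mul, sq_abs, ← pow_mul]
      exact mul_le_mul_of_nonneg_left (norm_inv_sq_add_sq_le hz x) (by rw [pow_mul]; positivity)
  rw [integral_mul_const] at h1
  rw [norm_mul, norm_mul, norm_pow, norm_neg, norm_one, one_pow, one_mul, norm_div, norm_pow]
  refine (mul_le_mul_of_nonneg_left h1 (by positivity)).trans (le_of_eq ?_)
  field_simp
  ring

/-- On the real axis the remainder has the sign of the first neglected term. The lower bound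
`(x² + t²)⁻¹ ≥ 2 l - l² (x² + t²)` survives the passage to the limit and yields strictness. -/
theorem stieltjesPhase_remainder_ofReal {m : Measure ℝ} [IsProbabilityMeasure m]
    (hm : ∀ᵐ t ∂m, 0 < t)
    (hint : ∀ n : ℕ, Integrable (fun t => t ^ n) m) {x : ℝ} (hx : 0 < x) (N : ℕ)
    (hpos : 0 < phaseMoment m (2 * N)) :
    ∃ R : ℝ, 0 < R ∧ R ≤ phaseMoment m (2 * N) * (1 / x ^ (2 * N + 1)) ∧
      stieltjesPhase m x + ∑ n ∈ range N,
          (-1 : ℂ) ^ n * (phaseMoment m (2 * n) : ℂ) * (1 / (x : ℂ) ^ (2 * n + 1)) =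
        (((-1) ^ (N + 1) * R : ℝ) : ℂ) := by
  obtain ⟨A, hA, hAB, hmom, hlim⟩ :=
    exists_seq_set_tendsto_remainder hm hint (z := x) (by simpa using hx) N
  set S := stieltjesPhase m x + ∑ n ∈ range N,
          (-1 : ℂ) ^ n * (phaseMoment m (2 * n) : ℂ) * (1 / (x : ℂ) ^ (2 * n + 1)) with hS
  set J : ℕ → ℝ := fun k => x / x ^ (2 * N) * ∫ t in A k, t ^ (2 * N) * (x ^ 2 + t ^ 2)⁻¹ with hJ
  have h1 : ∀ k, (-1) ^ (N + 1) * ((x : ℂ) / (x : ℂ) ^ (2 * N)) *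
        (∫ t in A k, (t : ℂ) ^ (2 * N) * ((x : ℂ) ^ 2 + (t : ℂ) ^ 2)⁻¹) =
      (((-1) ^ (N + 1) * J k : ℝ) : ℂ) := fun k => by
    have : ∫ t in A k, (t : ℂ) ^ (2 * N) * ((x : ℂ) ^ 2 + (t : ℂ) ^ 2)⁻¹ =
        ((∫ t in A k, t ^ (2 * N) * (x ^ 2 + t ^ 2)⁻¹ : ℝ) : ℂ) := by
      rw [← integral_complex_ofReal]
      push_cast
      rfl
    rw [this, hJ]
    push_cast
    ring
  simp_rw [h1] at hlim
  have hre := (Complex.continuous_re.tendsto _).comp hlim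
  have him := (Complex.continuous_im.tendsto _).comp hlim
  simp only [Function.comp_def, Complex.ofReal_re, Complex.ofReal_im] at hre him
  have hSim : S.im = 0 := tendsto_nhds_unique him tendsto_const_nhds
  have hsq : ((-1 : ℝ) ^ (N + 1)) * (-1) ^ (N + 1) = 1 := by
    rw [← mul_pow]; norm_num
  have hJlim : Tendsto J atTop (𝓝 ((-1) ^ (N + 1) * S.re)) := by
    have := hre.const_mul ((-1 : ℝ) ^ (N + 1))
    simp_rw [← mul_assoc, hsq, one_mul] at this
    exact this
  have hi : ∀ k (f : ℝ → ℝ), Continuous f → IntegrableOn f (A k) := fun k f hf => by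
    obtain ⟨B, hB⟩ := hAB k
    exact (hf.integrableOn_Ioc (a := 0) (b := B)).mono_set hB
  have hcont : Continuous fun t : ℝ => t ^ (2 * N) * (x ^ 2 + t ^ 2)⁻¹ :=
    (continuous_pow _).mul (Continuous.inv₀ (by fun_prop) fun t => by positivity)
  have hupper : (-1) ^ (N + 1) * S.re ≤ phaseMoment m (2 * N) * (1 / x ^ (2 * N + 1)) := by
    refine le_of_tendsto_of_tendsto' hJlim ((hmom (2 * N) (by omega)).mul_const _) fun k => ?_
    have h2 : ∫ t in A k, t ^ (2 * N) * (x ^ 2 + t ^ 2)⁻¹ ≤ ∫ t in A k, t ^ (2 * N) * (x ^ 2)⁻¹ := by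
      refine integral_mono (hi k _ hcont) (hi k _ (by fun_prop)) fun t => ?_
      refine mul_le_mul_of_nonneg_left (inv_anti₀ (by positivity) (by nlinarith [sq_nonneg t])) ?_
      rw [pow_mul]; positivity
    rw [integral_mul_const] at h2
    refine (mul_le_mul_of_nonneg_left h2 (by positivity)).trans (le_of_eq ?_)
    field_simp
    ring
  have hlower : ∀ l : ℝ, x / x ^ (2 * N) * (2 * l * phaseMoment m (2 * N) -
      l ^ 2 * (x ^ 2 * phaseMoment m (2 * N) + phaseMoment m (2 * N + 2))) ≤
      (-1) ^ (N + 1) * S.re := fun l => by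
    refine le_of_tendsto_of_tendsto' ((((hmom (2 * N) (by omega)).const_mul _).sub
      (((((hmom (2 * N) (by omega)).const_mul _).add (hmom (2 * N + 2) (by omega))).const_mul
        _))).const_mul _) hJlim fun k => ?_
    refine mul_le_mul_of_nonneg_left ?_ (by positivity)
    rw [← integral_const_mul, ← integral_const_mul, ← integral_add, ← integral_const_mul,
      ← integral_sub]
    · refine integral_mono (hi k _ (by fun_prop)) (hi k _ hcont) fun t => ?_
      have h3 : 0 < x ^ 2 + t ^ 2 := by positivity
      have h4 : 2 * l - l ^ 2 * (x ^ 2 + t ^ 2) ≤ (x ^ 2 + t ^ 2)⁻¹ := by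
        have h : (x ^ 2 + t ^ 2)⁻¹ - (2 * l - l ^ 2 * (x ^ 2 + t ^ 2)) =
            (x ^ 2 + t ^ 2)⁻¹ * (1 - l * (x ^ 2 + t ^ 2)) ^ 2 := by
          field_simp
          ring
        exact sub_nonneg.1 (h ▸ by positivity)
      have h5 : 0 ≤ t ^ (2 * N) := by rw [pow_mul]; positivity
      have := mul_le_mul_of_nonneg_left h4 h5
      refine le_trans (le_of_eq ?_) this
      ring
    all_goals exact hi k _ (by fun_prop)
  refine ⟨(-1) ^ (N + 1) * S.re, ?_, hupper, ?_⟩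
  · set c := phaseMoment m (2 * N)
    set D := x ^ 2 * c + phaseMoment m (2 * N + 2)
    -- The parabola `2 l c - l² D` is positive for small `l > 0`.
    have h6 : 0 < 2 * (c / (|D| + 1)) * c - (c / (|D| + 1)) ^ 2 * D := by
      have h7 : 0 < c / (|D| + 1) := by positivity
      have h8 : c / (|D| + 1) * D ≤ c := by
        rw [div_mul_eq_mul_div, div_le_iff₀ (by positivity)]
        exact mul_le_mul_of_nonneg_left (by linarith [le_abs_self D]) hpos.le
      nlinarith
    exact lt_of_lt_of_le (mul_pos (by positivity) h6) (hlower _)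
  · rw [← mul_assoc, hsq, one_mul]
    exact Complex.ext (by simp) (by simpa using hSim)

/-- The coefficients are positive as soon as the first two are, by Bernoulli's inequality
`t ^ n ≥ l ^ n + n l ^ (n - 1) (t - l)` with `l = c₁ / c₀`. -/
theorem phaseMoment_pos {m : Measure ℝ} [IsProbabilityMeasure m]
    (hm : ∀ᵐ t ∂m, 0 < t)
    (hint : ∀ n : ℕ, Integrable (fun t => t ^ n) m) (h0 : 0 < phaseMoment m 0)
    (h1 : 0 < phaseMoment m 1) (n : ℕ) : 0 < phaseMoment m n := by
  obtain ⟨A, hA, hAB, hmom, -⟩ :=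
    exists_seq_set hm hint (z := 1) (by simp) (n + 2)
  set l := phaseMoment m 1 / phaseMoment m 0 with hl
  have hl0 : 0 < l := div_pos h1 h0
  have hi : ∀ k (f : ℝ → ℝ), Continuous f → IntegrableOn f (A k) := fun k f hf => by
    obtain ⟨B, hB⟩ := hAB k
    exact (hf.integrableOn_Ioc (a := 0) (b := B)).mono_set hB
  have hlim1 := (hmom 1 (by omega)).const_mul (n * l⁻¹)
  have hlim0 := (hmom 0 (by omega)).const_mul (1 - n : ℝ)
  have h2 : l ^ n * ((1 - n : ℝ) * phaseMoment m 0 + n * l⁻¹ * phaseMoment m 1) ≤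
      phaseMoment m n := by
    refine le_of_tendsto_of_tendsto' ((hlim0.add hlim1).const_mul (l ^ n)) (hmom n (by omega))
      fun k => ?_
    rw [← integral_const_mul, ← integral_const_mul, ← integral_add, ← integral_const_mul]
    · refine setIntegral_mono_on (hi k _ (by fun_prop)) (hi k _ (by fun_prop)) (hA k) fun t ht => ?_
      obtain ⟨B, hB⟩ := hAB k
      have ht0 : 0 < t := (hB ht).1
      have h3 := one_add_mul_sub_le_pow (a := t / l) (by linarith [div_pos ht0 hl0]) n
      have h4 := mul_le_mul_of_nonneg_left h3 (pow_pos hl0 n).le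
      rw [← mul_pow, mul_div_cancel₀ _ hl0.ne'] at h4
      refine le_trans (le_of_eq ?_) h4
      ring
    all_goals exact hi k _ (by fun_prop)
  refine lt_of_lt_of_le (mul_pos (pow_pos hl0 n) ?_) h2
  have h5 : l⁻¹ * phaseMoment m 1 = phaseMoment m 0 := by
    rw [hl]; field_simp
  rw [mul_assoc, h5]
  linarith

/-! ### Analyticity, and the gamma distribution -/

theorem differentiableAt_stieltjes {m : Measure ℝ} [IsProbabilityMeasure m]
    (hint : Integrable (fun t : ℝ => t) m) {w : ℂ} (hw : w.im ≠ 0) :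
    DifferentiableAt ℂ (stieltjes m) w := by
  have hw2 : 0 < |w.im| / 2 := by have := abs_pos.2 hw; positivity
  have him : ∀ v ∈ Metric.ball w (|w.im| / 2), |w.im| / 2 ≤ |v.im| := fun v hv => by
    rw [Metric.mem_ball, dist_eq_norm] at hv
    have h1 := (Complex.abs_im_le_norm (v - w)).trans hv.le
    rw [Complex.sub_im, abs_sub_comm] at h1
    linarith [abs_sub_abs_le_abs_sub w.im v.im]
  have him0 : ∀ v ∈ Metric.ball w (|w.im| / 2), v.im ≠ 0 := fun v hv =>
    abs_pos.1 (hw2.trans_le (him v hv))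
  refine (hasDerivAt_integral_of_dominated_loc_of_deriv_le (F := fun v (t : ℝ) => v / (v + (t : ℂ)))
    (F' := fun v (t : ℝ) => (t : ℂ) / (v + (t : ℂ)) ^ 2)
    (bound := fun t => |t| * ((|w.im| / 2) ^ 2)⁻¹)
    (Metric.ball_mem_nhds w hw2) ?_ (integrable_div_add m hw) ?_ ?_ ?_ ?_).2.differentiableAt
  · filter_upwards [Metric.ball_mem_nhds w hw2] with v hv
    exact (continuous_div_add (him0 v hv)).aestronglyMeasurable
  · refine Continuous.aestronglyMeasurable (Complex.continuous_ofReal.div (by fun_prop) fun t => ?_)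
    exact pow_ne_zero 2 (Complex.slitPlane_ne_zero (add_ofReal_mem_slitPlane hw t))
  · refine Eventually.of_forall fun t v hv => ?_
    rw [norm_div, norm_pow, Complex.norm_real, Real.norm_eq_abs, div_eq_mul_inv]
    refine mul_le_mul_of_nonneg_left (inv_anti₀ (by positivity) ?_) (abs_nonneg t)
    refine pow_le_pow_left₀ hw2.le ((him v hv).trans ?_) 2
    simpa using Complex.abs_im_le_norm (v + t)
  · exact hint.abs.mul_const _
  · refine Eventually.of_forall fun t v hv => ?_
    have h0 := Complex.slitPlane_ne_zero (add_ofReal_mem_slitPlane (him0 v hv) t)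
    refine ((hasDerivAt_id v).div ((hasDerivAt_id v).add_const (t : ℂ)) h0).congr_deriv ?_
    simp

theorem analyticOnNhd_stieltjesPhase {m : Measure ℝ} [IsProbabilityMeasure m]
    (hm : ∀ᵐ t ∂m, 0 < t) (hint : Integrable (fun t : ℝ => t) m) :
    AnalyticOnNhd ℂ (stieltjesPhase m) {z : ℂ | 0 < z.re} := by
  refine DifferentiableOn.analyticOnNhd (fun z hz => ?_)
    (isOpen_lt continuous_const Complex.continuous_re)
  have hz' : z.re ≠ 0 := ne_of_gt hz
  have h1 : (-(Complex.I * z)).im ≠ 0 := by simpa using hz'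
  have h2 : (Complex.I * z).im ≠ 0 := by simpa using hz'
  have h3 : DifferentiableAt ℂ (fun z => stieltjes m (-(Complex.I * z))) z :=
    DifferentiableAt.comp (g := stieltjes m) z (differentiableAt_stieltjes hint h1) (by fun_prop)
  have h4 : DifferentiableAt ℂ (fun z => stieltjes m (Complex.I * z)) z :=
    DifferentiableAt.comp (g := stieltjes m) z (differentiableAt_stieltjes hint h2) (by fun_prop)
  exact (((h3.clog (stieltjes_mem_slitPlane hm h1)).sub
    (h4.clog (stieltjes_mem_slitPlane hm h2))).div_const _).differentiableWithinAt

theorem stieltjes_conj (m : Measure ℝ) (w : ℂ) :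
    stieltjes m (starRingEnd ℂ w) = starRingEnd ℂ (stieltjes m w) := by
  rw [stieltjes, stieltjes, ← integral_conj]
  simp

theorem stieltjesPhase_ofReal {m : Measure ℝ} [IsProbabilityMeasure m]
    (hm : ∀ᵐ t ∂m, 0 < t) {x : ℝ} (hx : 0 < x) :
    stieltjesPhase m x = ((stieltjes m (-(Complex.I * x))).arg : ℂ) := by
  have h1 : Complex.I * x = starRingEnd ℂ (-(Complex.I * x)) := by simp
  have hs := stieltjes_mem_slitPlane hm (w := -(Complex.I * x)) (by simpa using hx.ne')
  rw [stieltjesPhase, h1, stieltjes_conj, ← h1, Complex.log_conj _ (Complex.slitPlane_arg_ne_pi hs),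
    ← Complex.log_im]
  have h2 := Complex.I_ne_zero
  rw [Complex.sub_conj]
  push_cast
  field_simp

/-- The density of the Gamma distribution of shape `μ` and rate `1` on `(0, ∞)`. -/
noncomputable def gammaDensity (μ t : ℝ) : ℝ := (Real.Gamma μ)⁻¹ * (Real.exp (-t) * t ^ (μ - 1))

theorem gammaMeasure_eq_withDensity (μ : ℝ) : ProbabilityTheory.gammaMeasure μ 1 =
    (volume.restrict (Set.Ioi 0)).withDensity fun t => ENNReal.ofReal (gammaDensity μ t) := by
  rw [ProbabilityTheory.gammaMeasure, ← withDensity_indicator measurableSet_Ioi]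
  refine withDensity_congr_ae ?_
  have h0 : ∀ᵐ t : ℝ, t ≠ 0 := by simp [ae_iff, measure_singleton]
  filter_upwards [h0] with t ht
  rcases lt_or_gt_of_ne ht with h | h
  · rw [ProbabilityTheory.gammaPDF_of_neg h, Set.indicator_of_notMem (by simpa using h.le)]
  · rw [ProbabilityTheory.gammaPDF_of_nonneg h.le, Set.indicator_of_mem (by simpa using h),
      gammaDensity, Real.one_rpow, one_div, one_mul, mul_comm (Real.exp _), mul_assoc]

theorem measurable_gammaDensity (μ : ℝ) : Measurable (gammaDensity μ) := by
  unfold gammaDensity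
  fun_prop

theorem gammaDensity_pos {μ t : ℝ} (hμ : 0 < μ) (ht : 0 < t) : 0 < gammaDensity μ t := by
  have := Real.Gamma_pos_of_pos hμ
  unfold gammaDensity
  positivity

theorem integral_gammaMeasure {E : Type*} [NormedAddCommGroup E] [NormedSpace ℝ E] {μ : ℝ}
    (hμ : 0 < μ) (f : ℝ → E) : ∫ t, f t ∂(ProbabilityTheory.gammaMeasure μ 1) =
      ∫ t in Set.Ioi 0, gammaDensity μ t • f t := by
  rw [gammaMeasure_eq_withDensity, integral_withDensity_eq_integral_toReal_smul
    (measurable_gammaDensity μ).ennreal_ofReal (Eventually.of_forall fun t => ENNReal.ofReal_lt_top)]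
  refine setIntegral_congr_fun measurableSet_Ioi fun t ht => ?_
  simp only [ENNReal.toReal_ofReal (gammaDensity_pos hμ ht).le]

theorem integrable_gammaMeasure_iff {E : Type*} [NormedAddCommGroup E] [NormedSpace ℝ E] {μ : ℝ}
    (hμ : 0 < μ) (f : ℝ → E) : Integrable f (ProbabilityTheory.gammaMeasure μ 1) ↔
      IntegrableOn (fun t => gammaDensity μ t • f t) (Set.Ioi 0) := by
  rw [gammaMeasure_eq_withDensity, integrable_withDensity_iff_integrable_smul'
    (measurable_gammaDensity μ).ennreal_ofReal (Eventually.of_forall fun t => ENNReal.ofReal_lt_top)]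
  refine integrableOn_congr_fun (fun t ht => ?_) measurableSet_Ioi
  simp only [ENNReal.toReal_ofReal (gammaDensity_pos hμ ht).le]

theorem ae_pos_gammaMeasure (μ : ℝ) : ∀ᵐ t ∂(ProbabilityTheory.gammaMeasure μ 1), 0 < t := by
  rw [gammaMeasure_eq_withDensity]
  exact (withDensity_absolutelyContinuous _ _).ae_le (ae_restrict_mem measurableSet_Ioi)

theorem gammaDensity_mul_pow (μ : ℝ) {t : ℝ} (ht : 0 < t) (n : ℕ) :
    gammaDensity μ t * t ^ n = (Real.Gamma μ)⁻¹ * (Real.exp (-t) * t ^ (μ + n - 1)) := by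
  rw [gammaDensity, show μ + n - 1 = μ - 1 + n by ring, Real.rpow_add ht, Real.rpow_natCast]
  ring

theorem integrable_pow_gammaMeasure {μ : ℝ} (hμ : 0 < μ) (n : ℕ) :
    Integrable (fun t => t ^ n) (ProbabilityTheory.gammaMeasure μ 1) := by
  rw [integrable_gammaMeasure_iff hμ]
  refine IntegrableOn.congr_fun (Integrable.const_mul
    (Real.GammaIntegral_convergent (s := μ + n) (by positivity)) (Real.Gamma μ)⁻¹)
    (fun t ht => ?_) measurableSet_Ioi
  exact (gammaDensity_mul_pow μ ht n).symm

theorem integral_pow_gammaMeasure {μ : ℝ} (hμ : 0 < μ) (n : ℕ) :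
    ∫ t, t ^ n ∂(ProbabilityTheory.gammaMeasure μ 1) = (ascPochhammer ℝ n).eval μ := by
  have h1 : ∫ t, t ^ n ∂(ProbabilityTheory.gammaMeasure μ 1) =
      (Real.Gamma μ)⁻¹ * Real.Gamma (μ + n) := by
    rw [integral_gammaMeasure hμ, Real.Gamma_eq_integral (s := μ + n) (by positivity),
      ← integral_const_mul]
    exact setIntegral_congr_fun measurableSet_Ioi fun t ht => gammaDensity_mul_pow μ ht n
  rw [h1]
  have hG := (Real.Gamma_pos_of_pos hμ).ne'
  clear h1
  induction n with
  | zero => simp [hG]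
  | succ n ih =>
    rw [ascPochhammer_succ_eval, Nat.cast_succ, ← add_assoc,
      Real.Gamma_add_one (by positivity), ← ih]
    ring

/-! ### The incomplete gamma function as a Stieltjes transform -/

theorem gammaDensity_mul_exp (μ x t : ℝ) : gammaDensity μ t * Real.exp (x * t) =
    (Real.Gamma μ)⁻¹ * (t ^ (μ - 1) * Real.exp (-((1 - x) * t))) := by
  rw [gammaDensity, show -((1 - x) * t) = -t + x * t by ring, Real.exp_add]
  ring

theorem integrable_exp_gammaMeasure {μ x : ℝ} (hμ : 0 < μ) (hx : x < 1) :
    Integrable (fun t => Real.exp (x * t)) (ProbabilityTheory.gammaMeasure μ 1) := by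
  rw [integrable_gammaMeasure_iff hμ]
  refine IntegrableOn.congr_fun (Integrable.const_mul (integrableOn_rpow_mul_exp_neg_mul_rpow
    (p := 1) (s := μ - 1) (b := 1 - x) (by linarith) one_pos (by linarith)) (Real.Gamma μ)⁻¹)
    (fun t _ => ?_) measurableSet_Ioi
  simp only [Real.rpow_one, smul_eq_mul, gammaDensity_mul_exp, neg_mul]

theorem mgf_gammaMeasure {μ x : ℝ} (hμ : 0 < μ) (hx : x < 1) :
    ProbabilityTheory.mgf id (ProbabilityTheory.gammaMeasure μ 1) x = (1 - x) ^ (-μ) := by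
  rw [ProbabilityTheory.mgf, integral_gammaMeasure hμ]
  simp only [id, smul_eq_mul, gammaDensity_mul_exp]
  rw [integral_const_mul, Real.integral_rpow_mul_exp_neg_mul_Ioi hμ (by linarith), one_div,
    Real.inv_rpow (by linarith), Real.rpow_neg (by linarith), mul_comm _ (Real.Gamma μ),
    inv_mul_cancel_left₀ (Real.Gamma_pos_of_pos hμ).ne']

/-- The identity theorem extends the formula for the moment generating function from real to
complex arguments. -/
theorem complexMGF_gammaMeasure {μ : ℝ} (hμ : 0 < μ) {z : ℂ} (hz : z.re < 1) :
    ProbabilityTheory.complexMGF id (ProbabilityTheory.gammaMeasure μ 1) z = (1 - z) ^ (-μ : ℂ) := by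
  have hsub : Set.Iio (1 : ℝ) ⊆
      interior (ProbabilityTheory.integrableExpSet id (ProbabilityTheory.gammaMeasure μ 1)) :=
    interior_maximal (fun x hx => integrable_exp_gammaMeasure hμ hx) isOpen_Iio
  have h1 : AnalyticOnNhd ℂ (ProbabilityTheory.complexMGF id (ProbabilityTheory.gammaMeasure μ 1))
      {z : ℂ | z.re < 1} :=
    ProbabilityTheory.analyticOnNhd_complexMGF.mono fun z hz => hsub hz
  have h2 : AnalyticOnNhd ℂ (fun z : ℂ => (1 - z) ^ (-μ : ℂ)) {z : ℂ | z.re < 1} :=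
    DifferentiableOn.analyticOnNhd (fun z hz => (DifferentiableAt.cpow_const (by fun_prop)
      (Complex.mem_slitPlane_iff.2 (Or.inl (by
        have : z.re < 1 := hz
        simpa using this)))).differentiableWithinAt)
      (isOpen_lt Complex.continuous_re continuous_const)
  refine h1.eqOn_of_preconnected_of_frequently_eq h2
    (convex_halfSpace_re_lt 1).isPreconnected (z₀ := 0) (by simp) ?_ hz
  -- Both sides agree at real points, which accumulate at `0`.
  have hreal : ∀ᶠ x : ℝ in 𝓝[≠] 0,
      ProbabilityTheory.complexMGF id (ProbabilityTheory.gammaMeasure μ 1) (x : ℂ) =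
        (1 - (x : ℂ)) ^ (-μ : ℂ) := by
    filter_upwards [nhdsWithin_le_nhds (Iio_mem_nhds (zero_lt_one' ℝ))] with x hx
    have hx : x < 1 := hx
    rw [ProbabilityTheory.complexMGF_ofReal, mgf_gammaMeasure hμ hx,
      Complex.ofReal_cpow (by linarith)]
    push_cast
    rfl
  have ht : Tendsto (fun x : ℝ => (x : ℂ)) (𝓝[≠] 0) (𝓝[≠] 0) := by
    refine tendsto_nhdsWithin_iff.2 ⟨?_, ?_⟩
    · exact (Complex.continuous_ofReal.tendsto' 0 0 (by simp)).mono_left nhdsWithin_le_nhds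
    · filter_upwards [self_mem_nhdsWithin] with x hx
      simpa using hx
  exact ht.frequently hreal.frequently

/-- Up to elementary factors, the incomplete gamma function on the imaginary axis is the integral
`∫₀^∞ (z + i s)^(a-1) e^{-s} ds`, which in turn is a Stieltjes transform of a gamma measure:
`(1 + i s / z)^(a-1)` is the Laplace transform of that measure at `i s / z`. -/
theorem integral_cpow_mul_exp_eq_stieltjes {a z : ℝ} (ha : a < 1) (hz : 0 < z) :
    ∫ s in Set.Ioi (0 : ℝ), ((z : ℂ) + Complex.I * s) ^ ((a : ℂ) - 1) * Complex.exp (-(s : ℂ)) =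
      ((z ^ (a - 1) : ℝ) : ℂ) *
        stieltjes (ProbabilityTheory.gammaMeasure (1 - a) 1) (-(Complex.I * z)) := by
  have hμ : 0 < 1 - a := by linarith
  set m := ProbabilityTheory.gammaMeasure (1 - a) 1
  have : IsProbabilityMeasure m := ProbabilityTheory.isProbabilityMeasure_gammaMeasure hμ one_pos
  have hzC : (z : ℂ) ≠ 0 := by exact_mod_cast hz.ne'
  have h1 : ∀ s : ℝ, ((z : ℂ) + Complex.I * s) ^ ((a : ℂ) - 1) = ((z ^ (a - 1) : ℝ) : ℂ) *
      ∫ t, Complex.exp (-(Complex.I * (s / z) * t)) ∂m := fun s => by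
    have h2 : (z : ℂ) + Complex.I * s = z * (1 + Complex.I * (s / z)) := by field_simp
    have hre : (1 + Complex.I * ((s : ℂ) / z)).re = 1 := by
      rw [← Complex.ofReal_div]; simp
    have hne : 1 + Complex.I * ((s : ℂ) / z) ≠ 0 := fun h => by rw [h] at hre; simp at hre
    have h3 := complexMGF_gammaMeasure hμ (z := -(Complex.I * ((s : ℂ) / z)))
      (by rw [← Complex.ofReal_div]; simp)
    rw [ProbabilityTheory.complexMGF] at h3
    simp only [id, neg_mul] at h3
    rw [h3, h2, Complex.cpow_def_of_ne_zero (mul_ne_zero hzC hne), Complex.log_ofReal_mul hz hne,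
      add_mul, Complex.exp_add, Complex.ofReal_cpow hz.le, Complex.cpow_def_of_ne_zero hzC,
      Complex.cpow_def_of_ne_zero (by simpa using hne), Complex.ofReal_log hz.le]
    congr 2
    · push_cast; rfl
    · push_cast
      rw [sub_neg_eq_add]
      ring
  have hint : Integrable (fun p : ℝ × ℝ => Complex.exp (-(Complex.I * (p.1 / z) * p.2)) *
      Complex.exp (-(p.1 : ℂ))) ((volume.restrict (Set.Ioi 0)).prod m) := by
    have h4 : Integrable (fun s : ℝ => Real.exp (-s)) (volume.restrict (Set.Ioi 0)) := by
      simpa [IntegrableOn] using exp_neg_integrableOn_Ioi 0 one_pos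
    refine (h4.comp_fst m).mono' (by fun_prop) (Eventually.of_forall fun p => ?_)
    rw [norm_mul, Complex.norm_exp, Complex.norm_exp, ← Complex.ofReal_div]
    simp
  simp_rw [h1, mul_assoc _ (∫ t, _ ∂m), ← integral_mul_const]
  rw [integral_const_mul, integral_integral_swap hint, stieltjes]
  congr 1
  refine integral_congr_ae (Eventually.of_forall fun t => ?_)
  have hre : (-(1 + Complex.I * ((t : ℂ) / z))).re = -1 := by
    rw [← Complex.ofReal_div]; simp
  have hne : 1 + Complex.I * ((t : ℂ) / z) ≠ 0 := fun h => by rw [h] at hre; simp at hre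
  have h5 := integral_exp_mul_complex_Ioi (a := -(1 + Complex.I * ((t : ℂ) / z)))
    (by rw [hre]; norm_num) 0
  have h6 := Complex.slitPlane_ne_zero
    (add_ofReal_mem_slitPlane (w := -(Complex.I * z)) (by simpa using hz.ne') t)
  simp only
  calc ∫ s in Set.Ioi (0 : ℝ), Complex.exp (-(Complex.I * (s / z) * t)) * Complex.exp (-(s : ℂ))
      = ∫ s in Set.Ioi (0 : ℝ), Complex.exp (-(1 + Complex.I * ((t : ℂ) / z)) * s) := by
        refine integral_congr_ae (Eventually.of_forall fun s => ?_)
        simp only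
        rw [← Complex.exp_add]
        congr 1
        ring
    _ = -(Complex.I * z) / (-(Complex.I * z) + t) := by
        rw [h5, Complex.ofReal_zero, mul_zero, Complex.exp_zero, neg_div_neg_eq,
          div_eq_div_iff hne h6]
        field_simp
        linear_combination (t : ℂ) * Complex.I_sq

/-- `e^{π i a / 2} Γ(a, z e^{-π i / 2}) = i e^{i z} z^(a-1) W`, where `W` is the Stieltjes
transform at `-i z` of the gamma distribution of shape `1 - a`. -/
theorem exp_mul_upperIncGamma {a z : ℝ} (ha : a < 1) (hz : 0 < z) :
    Complex.exp ((Real.pi : ℂ) / 2 * Complex.I * (a : ℂ)) *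
        upperIncGamma (a : ℂ) ((z : ℂ) * Complex.exp (-((Real.pi : ℂ) / 2 * Complex.I))) =
      Complex.exp (Complex.I * ((z + Real.pi / 2 : ℝ) : ℂ)) * (((z ^ (a - 1) : ℝ) : ℂ) *
        stieltjes (ProbabilityTheory.gammaMeasure (1 - a) 1) (-(Complex.I * z))) := by
  have hexp : Complex.exp (-((Real.pi : ℂ) / 2 * Complex.I)) = -Complex.I := by
    rw [Complex.exp_neg, Complex.exp_pi_div_two_mul_I, Complex.inv_I]
  rw [← integral_cpow_mul_exp_eq_stieltjes ha hz, upperIncGamma, hexp, ← integral_const_mul,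
    ← integral_const_mul]
  refine setIntegral_congr_fun measurableSet_Ioi fun s hs => ?_
  have hs : 0 < s := hs
  have hre : 0 < ((z : ℂ) + Complex.I * s).re := by simpa using hz
  have hne : (z : ℂ) + Complex.I * s ≠ 0 := fun h => by rw [h] at hre; simp at hre
  have harg := abs_lt.1 (Complex.abs_arg_lt_pi_div_two_iff.2 (Or.inl hre))
  have h1 : (z : ℂ) * -Complex.I + s = -Complex.I * ((z : ℂ) + Complex.I * s) := by
    linear_combination (s : ℂ) * Complex.I_sq
  have h2 : Complex.log ((z : ℂ) * -Complex.I + s) =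
      -(Real.pi / 2) * Complex.I + Complex.log ((z : ℂ) + Complex.I * s) := by
    rw [h1, Complex.log_mul (neg_ne_zero.2 Complex.I_ne_zero) hne, Complex.log_neg_I]
    rw [Complex.arg_neg_I]
    constructor <;> linarith [Real.pi_pos]
  have hne' : (z : ℂ) * -Complex.I + s ≠ 0 := by
    rw [h1]; exact mul_ne_zero (neg_ne_zero.2 Complex.I_ne_zero) hne
  rw [Complex.cpow_def_of_ne_zero hne', Complex.cpow_def_of_ne_zero hne, h2, ← Complex.exp_add,
    ← Complex.exp_add, ← Complex.exp_add, ← Complex.exp_add]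
  congr 1
  push_cast
  ring

/-! ### Behaviour of the argument at the origin -/

/-- For `0 < a < 1` the integral `∫₀^∞ (z + i s)^(a-1) e^{-s} ds` converges to
`e^{π i (a-1) / 2} Γ(a)` as `z → 0`. -/
theorem tendsto_arg_stieltjes_of_pos {a : ℝ} (ha0 : 0 < a) (ha : a < 1) :
    Tendsto (fun z : ℝ => (stieltjes (ProbabilityTheory.gammaMeasure (1 - a) 1)
      (-(Complex.I * z))).arg) (𝓝[>] 0) (𝓝 (Real.pi / 2 * (a - 1))) := by
  have hG := Real.Gamma_pos_of_pos ha0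
  set θ := Real.pi / 2 * (a - 1) with hθ
  have hθ1 : -(Real.pi / 2) < θ := by rw [hθ]; nlinarith [Real.pi_pos]
  have hθ2 : θ < Real.pi / 2 := by rw [hθ]; nlinarith [Real.pi_pos]
  have hlim : Tendsto (fun z : ℝ => ∫ s in Set.Ioi (0 : ℝ),
      ((z : ℂ) + Complex.I * s) ^ ((a : ℂ) - 1) * Complex.exp (-(s : ℂ))) (𝓝[>] 0)
      (𝓝 (∫ s in Set.Ioi (0 : ℝ), (Complex.I * s) ^ ((a : ℂ) - 1) * Complex.exp (-(s : ℂ)))) := by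
    refine tendsto_integral_filter_of_dominated_convergence
      (fun s => Real.exp (-s) * s ^ (a - 1)) ?_ ?_ (Real.GammaIntegral_convergent ha0) ?_
    · exact Eventually.of_forall fun z => by fun_prop
    · filter_upwards [self_mem_nhdsWithin] with z hz
      filter_upwards [ae_restrict_mem measurableSet_Ioi] with s hs
      have hs : 0 < s := hs
      rw [norm_mul, Complex.norm_exp, mul_comm, show ((a : ℂ) - 1) = ((a - 1 : ℝ) : ℂ) by simp,
        Complex.norm_cpow_real, Complex.neg_re, Complex.ofReal_re]
      refine mul_le_mul_of_nonneg_left ?_ (Real.exp_pos _).le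
      refine Real.rpow_le_rpow_of_nonpos hs ?_ (by linarith)
      have := Complex.abs_im_le_norm ((z : ℂ) + Complex.I * s)
      simpa [abs_of_pos hs] using this
    · filter_upwards [ae_restrict_mem measurableSet_Ioi] with s hs
      have hs : 0 < s := hs
      have h1 : Tendsto (fun z : ℝ => (z : ℂ) + Complex.I * s) (𝓝[>] 0) (𝓝 (Complex.I * s)) := by
        refine Tendsto.mono_left ?_ nhdsWithin_le_nhds
        exact Continuous.tendsto' (by fun_prop) _ _ (by simp)
      refine Tendsto.mul_const _ ((continuousAt_cpow_const ?_).tendsto.comp h1)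
      exact Complex.mem_slitPlane_iff.2 (Or.inr (by simpa using hs.ne'))
  have hval : ∫ s in Set.Ioi (0 : ℝ), (Complex.I * s) ^ ((a : ℂ) - 1) * Complex.exp (-(s : ℂ)) =
      (Real.Gamma a : ℂ) * (Complex.cos θ + Complex.sin θ * Complex.I) := by
    rw [← Complex.exp_mul_I, Real.Gamma_eq_integral ha0, ← integral_complex_ofReal,
      ← integral_mul_const]
    refine setIntegral_congr_fun measurableSet_Ioi fun s hs => ?_
    have hs : 0 < s := hs
    have hsC : (s : ℂ) ≠ 0 := by exact_mod_cast hs.ne'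
    rw [mul_comm Complex.I, Complex.cpow_def_of_ne_zero (mul_ne_zero hsC Complex.I_ne_zero),
      Complex.log_ofReal_mul hs Complex.I_ne_zero, Complex.log_I, add_mul, Complex.exp_add,
      Complex.ofReal_mul, Complex.ofReal_cpow hs.le, Complex.cpow_def_of_ne_zero hsC,
      Complex.ofReal_log hs.le, hθ, Complex.ofReal_exp]
    push_cast
    ring_nf
  have harg : ((Real.Gamma a : ℂ) * (Complex.cos θ + Complex.sin θ * Complex.I)).arg = θ :=
    Complex.arg_mul_cos_add_sin_mul_I hG ⟨by linarith, by linarith⟩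
  have hslit : (Real.Gamma a : ℂ) * (Complex.cos θ + Complex.sin θ * Complex.I) ∈
      Complex.slitPlane := by
    rw [Complex.mem_slitPlane_iff_arg, harg]
    refine ⟨by linarith, mul_ne_zero (by exact_mod_cast hG.ne') ?_⟩
    rw [← Complex.exp_mul_I]
    exact Complex.exp_ne_zero _
  rw [hval] at hlim
  have h2 := (Complex.continuousAt_arg hslit).tendsto.comp hlim
  rw [harg] at h2
  refine h2.congr' ?_
  filter_upwards [self_mem_nhdsWithin] with z hz
  have hz : 0 < z := hz
  rw [Function.comp, integral_cpow_mul_exp_eq_stieltjes ha hz,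
    Complex.arg_real_mul _ (Real.rpow_pos_of_pos hz _)]

theorem re_div_add_neg_I_mul (z t : ℝ) :
    (-(Complex.I * z) / (-(Complex.I * z) + t)).re = z ^ 2 / (z ^ 2 + t ^ 2) := by
  rw [Complex.div_re]
  simp [Complex.normSq_apply]
  ring

theorem im_div_add_neg_I_mul (z t : ℝ) :
    (-(Complex.I * z) / (-(Complex.I * z) + t)).im = -(z * t / (z ^ 2 + t ^ 2)) := by
  rw [im_div_add]
  simp [Complex.normSq_apply]
  ring

/-- Near `z = 0` the real part is dominated by the imaginary part if the shape is at least `1`: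
the part `t > C z` of the integral contributes a fraction `1 / C`, the rest is of smaller order by
a logarithm. -/
theorem re_stieltjes_gammaMeasure_le {μ C z : ℝ} (hμ : 1 ≤ μ) (hC : 1 ≤ C) (hz : 0 < z)
    (hCz : C * z < 1) :
    (stieltjes (ProbabilityTheory.gammaMeasure μ 1) (-(Complex.I * z))).re ≤
      (C⁻¹ + 2 * Real.exp 1 * C / (-Real.log (C * z))) *
        -(stieltjes (ProbabilityTheory.gammaMeasure μ 1) (-(Complex.I * z))).im := by
  have hμ0 : 0 < μ := by linarith
  have hG := Real.Gamma_pos_of_pos hμ0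
  have hC0 : 0 < C := by linarith
  set m := ProbabilityTheory.gammaMeasure μ 1
  have : IsProbabilityMeasure m := ProbabilityTheory.isProbabilityMeasure_gammaMeasure hμ0 one_pos
  set δ := C * z with hδ
  have hδ0 : 0 < δ := by positivity
  have hint := integrable_div_add m (w := -(Complex.I * z)) (by simpa using hz.ne')
  set p : ℝ → ℝ := fun t => gammaDensity μ t * (z ^ 2 / (z ^ 2 + t ^ 2)) with hp
  set q : ℝ → ℝ := fun t => gammaDensity μ t * (z * t / (z ^ 2 + t ^ 2)) with hq
  have hP : (stieltjes m (-(Complex.I * z))).re = ∫ t in Set.Ioi 0, p t := by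
    rw [stieltjes]
    refine (integral_re (𝕜 := ℂ) hint).symm.trans ?_
    rw [integral_gammaMeasure hμ0]
    simp only [RCLike.re_eq_complex_re, re_div_add_neg_I_mul, smul_eq_mul, hp]
  have hQ : -(stieltjes m (-(Complex.I * z))).im = ∫ t in Set.Ioi 0, q t := by
    rw [stieltjes]
    refine (congrArg Neg.neg (integral_im (𝕜 := ℂ) hint).symm).trans ?_
    rw [integral_gammaMeasure hμ0, ← integral_neg]
    simp only [RCLike.im_eq_complex_im, im_div_add_neg_I_mul, smul_eq_mul, hq, mul_neg, neg_neg]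
  have hpi : IntegrableOn p (Set.Ioi 0) := by
    have := (integrable_gammaMeasure_iff hμ0 _).1 hint.re
    simpa only [RCLike.re_eq_complex_re, re_div_add_neg_I_mul, smul_eq_mul] using this
  have hqi : IntegrableOn q (Set.Ioi 0) := by
    have := ((integrable_gammaMeasure_iff hμ0 _).1 hint.im).neg
    simpa only [RCLike.im_eq_complex_im, im_div_add_neg_I_mul, smul_eq_mul, mul_neg, Pi.neg_def,
      neg_neg] using this
  have hq0 : ∀ t ∈ Set.Ioi (0 : ℝ), 0 ≤ q t := fun t ht =>
    mul_nonneg (gammaDensity_pos hμ0 ht).le (by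
      have : 0 < t := ht
      positivity)
  have hqmono : ∀ S ⊆ Set.Ioi (0 : ℝ), ∫ t in S, q t ≤ ∫ t in Set.Ioi 0, q t := fun S hS =>
    setIntegral_mono_set hqi ((ae_restrict_mem measurableSet_Ioi).mono fun t ht => hq0 t ht)
      hS.eventuallyLE
  have hsmall : ∫ t in Set.Ioc 0 δ, p t ≤ (Real.Gamma μ)⁻¹ * δ ^ (μ - 1) * δ := by
    have h1 : ∫ t in Set.Ioc 0 δ, p t ≤ ∫ t in Set.Ioc 0 δ, (Real.Gamma μ)⁻¹ * δ ^ (μ - 1) := by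
      refine setIntegral_mono_on (hpi.mono_set Set.Ioc_subset_Ioi_self) continuous_const.integrableOn_Ioc
        measurableSet_Ioc fun t ht => ?_
      have h2 : z ^ 2 / (z ^ 2 + t ^ 2) ≤ 1 :=
        div_le_one_of_le₀ (by nlinarith [sq_nonneg t]) (by positivity)
      have h3 : gammaDensity μ t ≤ (Real.Gamma μ)⁻¹ * δ ^ (μ - 1) := by
        refine mul_le_mul_of_nonneg_left ?_ (inv_pos.2 hG).le
        have h4 : Real.exp (-t) ≤ 1 := Real.exp_le_one_iff.2 (by linarith [ht.1])
        have h5 : t ^ (μ - 1) ≤ δ ^ (μ - 1) := Real.rpow_le_rpow ht.1.le ht.2 (by linarith)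
        have h6 : 0 ≤ t ^ (μ - 1) := Real.rpow_nonneg ht.1.le _
        nlinarith
      exact (mul_le_of_le_one_right (gammaDensity_pos hμ0 ht.1).le h2).trans h3
    refine h1.trans (le_of_eq ?_)
    rw [setIntegral_const, smul_eq_mul, mul_comm]
    simp [hδ0.le]
  have hlarge : ∫ t in Set.Ioi δ, p t ≤ C⁻¹ * ∫ t in Set.Ioi 0, q t := by
    have hsub : Set.Ioi δ ⊆ Set.Ioi 0 := Set.Ioi_subset_Ioi hδ0.le
    refine le_trans ?_ (mul_le_mul_of_nonneg_left (hqmono _ hsub) (inv_pos.2 hC0).le)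
    rw [← integral_const_mul]
    refine setIntegral_mono_on (hpi.mono_set hsub) ((hqi.mono_set hsub).const_mul _)
      measurableSet_Ioi fun t ht => ?_
    have ht' : δ < t := ht
    have ht0 : 0 < t := hδ0.trans ht'
    have h2 : z ^ 2 / (z ^ 2 + t ^ 2) ≤ C⁻¹ * (z * t / (z ^ 2 + t ^ 2)) := by
      rw [mul_div_assoc']
      refine div_le_div_of_nonneg_right ?_ (by positivity)
      rw [inv_mul_eq_div, le_div_iff₀ hC0]
      nlinarith
    refine (mul_le_mul_of_nonneg_left h2 (gammaDensity_pos hμ0 ht0).le).trans (le_of_eq ?_)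
    simp only [hq]
    ring
  have hlog : Real.log δ < 0 := Real.log_neg hδ0 hCz
  have hlower : (Real.Gamma μ)⁻¹ * ((Real.exp 1)⁻¹ * δ ^ (μ - 1)) * (z / 2) * (-Real.log δ) ≤
      ∫ t in Set.Ioi 0, q t := by
    have hsub : Set.Ioc δ 1 ⊆ Set.Ioi 0 := fun t ht => hδ0.trans ht.1
    refine le_trans ?_ (hqmono _ hsub)
    have h1 : ∫ t in Set.Ioc δ 1, (Real.Gamma μ)⁻¹ * ((Real.exp 1)⁻¹ * δ ^ (μ - 1)) * (z / 2) *
        (1 / t) ≤ ∫ t in Set.Ioc δ 1, q t := by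
      refine setIntegral_mono_on ?_ (hqi.mono_set hsub) measurableSet_Ioc fun t ht => ?_
      · have h0 : IntegrableOn (fun t : ℝ => 1 / t) (Set.Icc δ 1) := by
          refine ContinuousOn.integrableOn_Icc ?_
          exact continuousOn_const.div continuousOn_id fun t ht => (hδ0.trans_le ht.1).ne'
        exact Integrable.const_mul (h0.mono_set Set.Ioc_subset_Icc_self) _
      · have ht0 : 0 < t := hδ0.trans ht.1
        have hzt : z ≤ t := by nlinarith [ht.1]
        have h2 : z / 2 * (1 / t) ≤ z * t / (z ^ 2 + t ^ 2) := by
          rw [div_mul_div_comm, mul_one, div_le_div_iff₀ (by positivity) (by positivity)]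
          nlinarith [mul_nonneg hz.le (sub_nonneg.2 (pow_le_pow_left₀ hz.le hzt 2))]
        have h3 : (Real.Gamma μ)⁻¹ * ((Real.exp 1)⁻¹ * δ ^ (μ - 1)) ≤ gammaDensity μ t := by
          refine mul_le_mul_of_nonneg_left ?_ (inv_pos.2 hG).le
          refine mul_le_mul ?_ (Real.rpow_le_rpow hδ0.le ht.1.le (by linarith))
            (by positivity) (by positivity)
          rw [← Real.exp_neg]
          exact Real.exp_le_exp.2 (by linarith [ht.2])
        rw [mul_assoc _ (z / 2)]
        exact mul_le_mul h3 h2 (by positivity) (gammaDensity_pos hμ0 ht0).le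
    refine le_trans (le_of_eq ?_) h1
    rw [integral_const_mul, ← intervalIntegral.integral_of_le hCz.le,
      integral_one_div_of_pos hδ0 one_pos, one_div, Real.log_inv]
  have hsplit : ∫ t in Set.Ioi 0, p t = (∫ t in Set.Ioc 0 δ, p t) + ∫ t in Set.Ioi δ, p t := by
    rw [← Set.Ioc_union_Ioi_eq_Ioi hδ0.le]
    exact setIntegral_union (Set.Ioc_disjoint_Ioi le_rfl) measurableSet_Ioi
      (hpi.mono_set Set.Ioc_subset_Ioi_self) (hpi.mono_set (Set.Ioi_subset_Ioi hδ0.le))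
  rw [hP, hQ, hsplit, add_mul, add_comm (C⁻¹ * _)]
  refine add_le_add (hsmall.trans ?_) hlarge
  have h7 : 0 < 2 * Real.exp 1 * C / (-Real.log δ) := by
    have := neg_pos.2 hlog
    positivity
  refine le_trans (le_of_eq ?_) (mul_le_mul_of_nonneg_left hlower h7.le)
  have hL := (neg_pos.2 hlog).ne'
  have hE := (Real.exp_pos 1).ne'
  generalize -Real.log δ = L at *
  have hδz : δ = C * z := rfl
  generalize δ ^ (μ - 1) = D at *
  rw [hδz]
  field_simp

/-- The argument tends to `-π / 2` at `0` if the shape is at least `1`. -/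
theorem tendsto_arg_stieltjes_of_nonpos {μ : ℝ} (hμ : 1 ≤ μ) :
    Tendsto (fun z : ℝ => (stieltjes (ProbabilityTheory.gammaMeasure μ 1)
      (-(Complex.I * z))).arg) (𝓝[>] 0) (𝓝 (-(Real.pi / 2))) := by
  have hμ0 : 0 < μ := by linarith
  set m := ProbabilityTheory.gammaMeasure μ 1
  have : IsProbabilityMeasure m := ProbabilityTheory.isProbabilityMeasure_gammaMeasure hμ0 one_pos
  set W : ℝ → ℂ := fun z => stieltjes m (-(Complex.I * z)) with hW
  have him : ∀ z : ℝ, 0 < z → 0 < -(W z).im := fun z hz => by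
    have := im_mul_im_stieltjes_pos (ae_pos_gammaMeasure μ) (w := -(Complex.I * z))
      (by simpa using hz.ne')
    have h1 : (-(Complex.I * (z : ℂ))).im = -z := by simp
    rw [h1] at this
    have h2 : 0 < z * -(W z).im := by rw [hW]; linarith
    exact pos_of_mul_pos_right h2 hz.le
  have hre : ∀ z : ℝ, 0 ≤ (W z).re := fun z => by
    by_cases hz : z = 0
    · simp [hW, hz, stieltjes]
    · have h1 : (W z).re = ∫ t, (-(Complex.I * z) / (-(Complex.I * z) + (t : ℝ))).re ∂m :=
        (integral_re (𝕜 := ℂ) (integrable_div_add m (by simpa using hz))).symm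
      rw [h1]
      refine integral_nonneg fun t => ?_
      rw [Pi.zero_apply, re_div_add_neg_I_mul]
      positivity
  have hratio : Tendsto (fun z => (W z).re / -(W z).im) (𝓝[>] 0) (𝓝 0) := by
    rw [Metric.tendsto_nhds]
    intro ε hε
    set C := max 1 (4 / ε) with hC
    have hC1 : 1 ≤ C := le_max_left _ _
    have hC2 : 4 / ε ≤ C := le_max_right _ _
    have hC0 : 0 < C := by linarith
    have hlim : Tendsto (fun z => C * z) (𝓝[>] 0) (𝓝[>] 0) := by
      refine tendsto_nhdsWithin_iff.2 ⟨?_, ?_⟩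
      · exact (Continuous.tendsto' (by fun_prop) _ _ (by simp)).mono_left nhdsWithin_le_nhds
      · filter_upwards [self_mem_nhdsWithin] with z hz
        exact mul_pos hC0 hz
    have hlog := (Real.tendsto_log_nhdsGT_zero.comp hlim).eventually_lt_atBot
      (-(8 * Real.exp 1 * C / ε))
    filter_upwards [self_mem_nhdsWithin, hlog] with z hz hlz
    have hz : 0 < z := hz
    simp only [Function.comp] at hlz
    have hpos : 0 < 8 * Real.exp 1 * C / ε := by positivity
    have hCz : C * z < 1 := (Real.log_neg_iff (by positivity)).1 (by linarith)
    have h1 := re_stieltjes_gammaMeasure_le hμ hC1 hz hCz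
    have h2 : C⁻¹ ≤ ε / 4 := by
      rw [inv_le_comm₀ hC0 (by positivity), inv_div]; exact hC2
    have h3 : 2 * Real.exp 1 * C / (-Real.log (C * z)) ≤ ε / 4 := by
      rw [div_le_iff₀ (by linarith)]
      have : ε / 4 * (8 * Real.exp 1 * C / ε) = 2 * Real.exp 1 * C := by field_simp; ring
      rw [← this]
      exact mul_le_mul_of_nonneg_left (by linarith) (by positivity)
    have h4 : (W z).re / -(W z).im ≤ ε / 2 := by
      rw [div_le_iff₀ (him z hz)]
      refine h1.trans (mul_le_mul_of_nonneg_right (by linarith) (him z hz).le)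
    rw [Real.dist_eq, sub_zero, abs_of_nonneg (div_nonneg (hre z) (him z hz).le)]
    linarith
  have hlim : Tendsto (fun z => (((W z).re / -(W z).im : ℝ) : ℂ) - Complex.I) (𝓝[>] 0)
      (𝓝 (-Complex.I)) := by
    have := ((Complex.continuous_ofReal.tendsto _).comp hratio).sub_const Complex.I
    simpa using this
  have h5 := (Complex.continuousAt_arg (x := -Complex.I)
    (Complex.mem_slitPlane_iff.2 (Or.inr (by simp)))).tendsto.comp hlim
  rw [Complex.arg_neg_I] at h5
  refine h5.congr' ?_
  filter_upwards [self_mem_nhdsWithin] with z hz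
  have h6 := him z hz
  rw [Function.comp, ← Complex.arg_real_mul _ h6]
  congr 1
  change _ = W z
  apply Complex.ext
  · rw [Complex.re_ofReal_mul, Complex.sub_re, Complex.ofReal_re, Complex.I_re, sub_zero,
      mul_div_cancel₀ _ h6.ne']
  · rw [Complex.im_ofReal_mul, Complex.sub_im, Complex.ofReal_im, Complex.I_im]
    ring

/-! ### The phase function -/

/-- Two continuous real functions on `(0, ∞)` that agree modulo `2 π` and have the same limit at
`0` coincide. -/
theorem eqOn_of_exp_I_mul_eq {f g : ℝ → ℝ} (hf : ContinuousOn f (Set.Ioi 0))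
    (hg : ContinuousOn g (Set.Ioi 0))
    (h : ∀ x, 0 < x → Complex.exp (Complex.I * f x) = Complex.exp (Complex.I * g x)) {c : ℝ}
    (hfc : Tendsto f (𝓝[>] 0) (𝓝 c)) (hgc : Tendsto g (𝓝[>] 0) (𝓝 c)) {x : ℝ} (hx : 0 < x) :
    f x = g x := by
  have hint : ∀ x, 0 < x → ∃ n : ℤ, f x - g x = n * (2 * Real.pi) := fun x hx => by
    obtain ⟨n, hn⟩ := Complex.exp_eq_exp_iff_exists_int.1 (h x hx)
    refine ⟨n, ?_⟩
    have h1 : Complex.I * ((f x : ℂ) - g x - n * (2 * Real.pi)) = 0 := by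
      linear_combination hn
    have h2 := (mul_eq_zero.1 h1).resolve_left Complex.I_ne_zero
    have h3 : f x - g x - n * (2 * Real.pi) = 0 := by exact_mod_cast h2
    linarith
  have hne : ∀ x, 0 < x → |f x - g x| ≠ Real.pi := fun x hx h0 => by
    obtain ⟨n, hn⟩ := hint x hx
    rw [hn, abs_mul, abs_of_pos (by positivity : 0 < 2 * Real.pi)] at h0
    have h1 : |(n : ℝ)| * 2 = 1 := by
      have := Real.pi_pos.ne'
      field_simp at h0
      linarith
    have h2 : |n| * 2 = 1 := by exact_mod_cast h1
    omega
  -- A nonzero difference has absolute value at least `2 π`, and it tends to `0` at `0`, so its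
  -- absolute value would be `π` somewhere in between.
  by_contra hfg
  have hbig : Real.pi < |f x - g x| := by
    obtain ⟨n, hn⟩ := hint x hx
    have hn0 : n ≠ 0 := fun h0 => hfg (by rw [h0] at hn; simp at hn; linarith)
    have h1 : (1 : ℝ) ≤ |(n : ℝ)| := by exact_mod_cast Int.one_le_abs hn0
    rw [hn, abs_mul, abs_of_pos (by positivity : 0 < 2 * Real.pi)]
    nlinarith [Real.pi_pos]
  have hcont : ContinuousOn (fun x => |f x - g x|) (Set.Ioi 0) := (hf.sub hg).abs
  have hlim : Tendsto (fun x => |f x - g x|) (𝓝[>] 0) (𝓝 0) := by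
    simpa using (hfc.sub hgc).abs
  obtain ⟨y, hy, hy0⟩ := ((hlim.eventually (gt_mem_nhds Real.pi_pos)).and
    self_mem_nhdsWithin).exists
  obtain ⟨u, hu, hu'⟩ := isPreconnected_Ioi.intermediate_value hy0 hx hcont ⟨hy.le, hbig.le⟩
  exact hne u hu hu'

/-- The phase function for `z > 0`. The branch is the one for which the argument of the transform
is principal. -/
noncomputable def gammaPhase (a z : ℝ) : ℝ :=
  z + Real.pi / 2 +
    (stieltjes (ProbabilityTheory.gammaMeasure (1 - a) 1) (-(Complex.I * z))).arg

/-- The modulus function, for `z > 0`. -/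
noncomputable def gammaModulus (a z : ℝ) : ℝ :=
  z ^ (a - 1) * ‖stieltjes (ProbabilityTheory.gammaMeasure (1 - a) 1) (-(Complex.I * z))‖

theorem isModulusPhase_gamma {a : ℝ} (ha : a < 1) :
    IsModulusPhase a (gammaModulus a) (gammaPhase a) := by
  have hμ : 0 < 1 - a := by linarith
  have : IsProbabilityMeasure (ProbabilityTheory.gammaMeasure (1 - a) 1) :=
    ProbabilityTheory.isProbabilityMeasure_gammaMeasure hμ one_pos
  have hpos := ae_pos_gammaMeasure (1 - a)
  have hint : Integrable (fun t : ℝ => t) (ProbabilityTheory.gammaMeasure (1 - a) 1) := by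
    simpa using integrable_pow_gammaMeasure hμ 1
  have him : ∀ z : ℝ, 0 < z → (-(Complex.I * (z : ℂ))).im ≠ 0 := fun z hz => by
    simpa using hz.ne'
  have hcont : ∀ z : ℝ, 0 < z → ContinuousAt (fun z : ℝ =>
      stieltjes (ProbabilityTheory.gammaMeasure (1 - a) 1) (-(Complex.I * z))) z := fun z hz => by
    refine ContinuousAt.comp (f := fun z : ℝ => -(Complex.I * (z : ℂ)))
      (g := stieltjes (ProbabilityTheory.gammaMeasure (1 - a) 1)) ?_ (by fun_prop)
    exact (differentiableAt_stieltjes hint (him z hz)).continuousAt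
  refine ⟨fun z hz => ?_, fun z hz => ?_, fun z hz => ?_, fun z hz => ?_, ?_⟩
  · have hz : 0 < z := hz
    exact ((Real.continuousAt_rpow_const z _ (Or.inl hz.ne')).mul
      (hcont z hz).norm).continuousWithinAt
  · have hz : 0 < z := hz
    have h1 := (Complex.continuousAt_arg (stieltjes_mem_slitPlane hpos (him z hz))).comp
      (f := fun z : ℝ => stieltjes (ProbabilityTheory.gammaMeasure (1 - a) 1) (-(Complex.I * z)))
      (hcont z hz)
    exact (ContinuousAt.add (by fun_prop) h1).continuousWithinAt
  · exact mul_pos (Real.rpow_pos_of_pos hz _) (norm_pos_iff.2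
      (Complex.slitPlane_ne_zero (stieltjes_mem_slitPlane hpos (him z hz))))
  · rw [exp_mul_upperIncGamma ha hz, gammaModulus, gammaPhase]
    generalize stieltjes (ProbabilityTheory.gammaMeasure (1 - a) 1) (-(Complex.I * z)) = W
    conv_rhs => rw [← Complex.norm_mul_exp_arg_mul_I W]
    push_cast
    rw [mul_add Complex.I, Complex.exp_add, mul_comm Complex.I (W.arg : ℂ)]
    ring
  · have h0 : Tendsto (fun z : ℝ => z + Real.pi / 2) (𝓝[>] 0) (𝓝 (Real.pi / 2)) :=
      (Continuous.tendsto' (by fun_prop) _ _ (by simp)).mono_left nhdsWithin_le_nhds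
    rcases le_or_gt a 0 with h | h
    · have h1 := h0.add (tendsto_arg_stieltjes_of_nonpos (μ := 1 - a) (by linarith))
      rw [abs_of_nonpos h]
      refine h1.trans (le_of_eq (congrArg 𝓝 ?_))
      ring
    · have h1 := h0.add (tendsto_arg_stieltjes_of_pos h ha)
      rw [abs_of_pos h]
      refine h1.trans (le_of_eq (congrArg 𝓝 ?_))
      ring

theorem IsModulusPhase.phase_unique {a : ℝ} {M M' φ φ' : ℝ → ℝ} (h : IsModulusPhase a M φ)
    (h' : IsModulusPhase a M' φ') {x : ℝ} (hx : 0 < x) : φ x = φ' x := by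
  refine eqOn_of_exp_I_mul_eq h.continuousOn_phase h'.continuousOn_phase (fun z hz => ?_)
    h.tendsto_phase h'.tendsto_phase hx
  have h1 := (h.polar z hz).trans (h'.polar z hz).symm
  have hM := h.modulus_pos z hz
  have hM' := h'.modulus_pos z hz
  have h2 := congrArg norm h1
  have hn : ∀ r : ℝ, ‖Complex.exp (Complex.I * (r : ℂ))‖ = 1 := fun r => by
    rw [mul_comm, Complex.norm_exp_ofReal_mul_I]
  rw [norm_mul, norm_mul, hn, hn, mul_one, mul_one, Complex.norm_real, Complex.norm_real,
    Real.norm_of_nonneg hM.le, Real.norm_of_nonneg hM'.le] at h2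
  rw [h2] at h1
  exact mul_left_cancel₀ (by exact_mod_cast hM'.ne') h1

theorem aeval_newtonSum_ascPochhammer {μ : ℝ} (hμ : 0 < μ) (n : ℕ) :
    Polynomial.aeval μ (newtonSum (ascPochhammer ℤ) n) =
      phaseMoment (ProbabilityTheory.gammaMeasure μ 1) n * (n + 1) := by
  rw [phaseMoment, div_mul_cancel₀ _ (by positivity)]
  simp_rw [integral_pow_gammaMeasure hμ]
  refine (map_newtonSum (Polynomial.aeval μ : ℤ[X] →ₐ[ℤ] ℝ).toRingHom _ n).trans ?_
  congr 1
  ext k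
  rw [← ascPochhammer_map (algebraMap ℤ ℝ), Polynomial.eval_map_algebraMap]
  rfl

theorem phaseMoment_gammaMeasure_pos {μ : ℝ} (hμ : 0 < μ) (n : ℕ) :
    0 < phaseMoment (ProbabilityTheory.gammaMeasure μ 1) n := by
  have : IsProbabilityMeasure (ProbabilityTheory.gammaMeasure μ 1) :=
    ProbabilityTheory.isProbabilityMeasure_gammaMeasure hμ one_pos
  have h0 : newtonSum (fun j => ∫ t, t ^ j ∂(ProbabilityTheory.gammaMeasure μ 1)) 0 = μ := by
    rw [newtonSum_eq]
    simp_rw [integral_pow_gammaMeasure hμ]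
    simp
  refine phaseMoment_pos (ae_pos_gammaMeasure μ) (integrable_pow_gammaMeasure hμ) ?_ ?_ n
  · rw [phaseMoment, h0]
    positivity
  · rw [phaseMoment, newtonSum_eq, sum_range_one, h0]
    simp_rw [integral_pow_gammaMeasure hμ]
    simp [ascPochhammer_succ_eval]
    nlinarith

theorem theorem2 :
    ∃ t : ℕ → ℤ[X],
      (∀ n : ℕ, (t n).Monic ∧ (t n).natDegree = 2 * n + 1) ∧
      ∀ a : ℝ, a < 1 →
        (∀ n : ℕ, 0 < Polynomial.aeval (1 - a) (t n)) ∧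
        (∃ M φ : ℝ → ℝ, IsModulusPhase a M φ) ∧
        ∀ M φ : ℝ → ℝ, IsModulusPhase a M φ →
          HasPhaseExpansion φ (fun n => Polynomial.aeval (1 - a) (t n)) ∧
          ∃ Φ : ℂ → ℂ,
            AnalyticOnNhd ℂ Φ {z : ℂ | 0 < z.re} ∧
            (∀ x : ℝ, 0 < x → Φ (x : ℂ) = (φ x : ℂ)) ∧
            ∀ N : ℕ,
              (∀ z : ℂ, 0 < z.re →
                ‖Φ z - phasePartialSum (fun n => Polynomial.aeval (1 - a) (t n)) N z‖ ≤
                  Polynomial.aeval (1 - a) (t N) / (2 * (N : ℝ) + 1) *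
                    (1 / ‖z‖ ^ (2 * N + 1)) * phaseErrorFactor z.arg) ∧
              (∀ x : ℝ, 0 < x → ∃ R : ℝ,
                Φ (x : ℂ) =
                  phasePartialSum (fun n => Polynomial.aeval (1 - a) (t n)) N (x : ℂ) + (R : ℂ) ∧
                |R| ≤ |(-1 : ℝ) ^ (N + 1) * (Polynomial.aeval (1 - a) (t N) / (2 * (N : ℝ) + 1)) *
                    (1 / x ^ (2 * N + 1))| ∧
                SignType.sign R =
                  SignType.sign ((-1 : ℝ) ^ (N + 1) *
                    (Polynomial.aeval (1 - a) (t N) / (2 * (N : ℝ) + 1)) *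
                      (1 / x ^ (2 * N + 1)))) := by
  refine ⟨fun n => newtonSum (ascPochhammer ℤ) (2 * n),
    fun n => newtonSum_ascPochhammer_monic (2 * n), fun a ha => ?_⟩
  have hμ : 0 < 1 - a := by linarith
  set m := ProbabilityTheory.gammaMeasure (1 - a) 1
  have : IsProbabilityMeasure m := ProbabilityTheory.isProbabilityMeasure_gammaMeasure hμ one_pos
  have hpos : ∀ᵐ t ∂m, 0 < t := ae_pos_gammaMeasure (1 - a)
  have hint : ∀ n : ℕ, Integrable (fun t => t ^ n) m := integrable_pow_gammaMeasure hμ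
  have hmom : ∀ n, 0 < phaseMoment m n := phaseMoment_gammaMeasure_pos hμ
  have hcoef : ∀ n : ℕ, Polynomial.aeval (1 - a) (newtonSum (ascPochhammer ℤ) (2 * n)) =
      phaseMoment m (2 * n) * (2 * (n : ℝ) + 1) := fun n => by
    rw [aeval_newtonSum_ascPochhammer hμ]
    push_cast
    rfl
  have hcoef' : ∀ n : ℕ, Polynomial.aeval (1 - a) (newtonSum (ascPochhammer ℤ) (2 * n)) /
      (2 * (n : ℝ) + 1) = phaseMoment m (2 * n) := fun n => by
    rw [hcoef, mul_div_cancel_right₀ _ (by positivity)]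
  have hpart : ∀ (N : ℕ) (z : ℂ), z + (Real.pi : ℂ) / 2 + stieltjesPhase m z -
      phasePartialSum (fun n => Polynomial.aeval (1 - a) (newtonSum (ascPochhammer ℤ) (2 * n))) N z =
      stieltjesPhase m z + ∑ n ∈ range N,
        (-1 : ℂ) ^ n * (phaseMoment m (2 * n) : ℂ) * (1 / z ^ (2 * n + 1)) := fun N z => by
    have h1 : ∀ n : ℕ, ((Polynomial.aeval (1 - a) (newtonSum (ascPochhammer ℤ) (2 * n)) : ℝ) : ℂ) /
        (2 * (n : ℂ) + 1) = (phaseMoment m (2 * n) : ℂ) := fun n => by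
      rw [← hcoef' n]; push_cast; rfl
    rw [phasePartialSum]
    simp only [h1]
    ring
  refine ⟨fun n => ?_, ⟨_, _, isModulusPhase_gamma ha⟩, fun M φ hφ => ?_⟩
  · rw [hcoef]
    exact mul_pos (hmom _) (by positivity)
  have hreal : ∀ x : ℝ, 0 < x →
      (x : ℂ) + (Real.pi : ℂ) / 2 + stieltjesPhase m x = (φ x : ℂ) := fun x hx => by
    rw [hφ.phase_unique (isModulusPhase_gamma ha) hx, gammaPhase, stieltjesPhase_ofReal hpos hx]
    push_cast
    rfl
  have hbound : ∀ (N : ℕ) (z : ℂ), 0 < z.re → ‖z + (Real.pi : ℂ) / 2 + stieltjesPhase m z -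
      phasePartialSum (fun n => Polynomial.aeval (1 - a) (newtonSum (ascPochhammer ℤ) (2 * n))) N z‖ ≤
      phaseMoment m (2 * N) * (1 / ‖z‖ ^ (2 * N + 1)) * phaseErrorFactor z.arg := fun N z hz => by
    rw [hpart]
    exact stieltjesPhase_remainder_norm_le hpos hint hz N
  refine ⟨fun N => ?_, fun z => z + (Real.pi : ℂ) / 2 + stieltjesPhase m z, ?_, hreal,
    fun N => ⟨fun z hz => ?_, fun x hx => ?_⟩⟩
  · refine Asymptotics.IsBigO.of_bound (phaseMoment m (2 * N)) ?_
    filter_upwards [eventually_gt_atTop 0] with x hx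
    have h1 := hbound N x (by simpa using hx)
    rw [hreal x hx, Complex.arg_ofReal_of_nonneg hx.le, phaseErrorFactor,
      if_pos (by rw [abs_zero]; positivity), mul_one, Complex.norm_real] at h1
    rwa [norm_div, norm_one, norm_pow]
  · have h1 : AnalyticOnNhd ℂ (fun z : ℂ => z + (Real.pi : ℂ) / 2) {z : ℂ | 0 < z.re} :=
      fun z _ => by fun_prop
    exact h1.add (analyticOnNhd_stieltjesPhase hpos (by simpa using hint 1))
  · rw [hcoef']
    exact hbound N z hz
  · obtain ⟨R, hR0, hR, hRe⟩ := stieltjesPhase_remainder_ofReal hpos hint hx N (hmom _)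
    refine ⟨(-1) ^ (N + 1) * R, ?_, ?_, ?_⟩
    · rw [← hRe, ← hpart]
      ring
    · rw [hcoef', mul_assoc, abs_mul, abs_mul ((-1) ^ (N + 1)), abs_of_pos hR0]
      exact mul_le_mul_of_nonneg_left (hR.trans (le_abs_self _)) (abs_nonneg _)
    · have h2 : 0 < phaseMoment m (2 * N) * (1 / x ^ (2 * N + 1)) :=
        mul_pos (hmom _) (by positivity)
      rw [hcoef', mul_assoc, sign_mul, sign_mul, sign_pos hR0, sign_pos h2]
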